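/- Let $(V,\eta)$ be a Lorentzian vector space of signature $(1,10)$, let $S\cong\mathbb R^{32}$ be an irreducible real module of its Clifford algebra (with $v\cdot v=-\eta(v,v)$), and let $\langle-,-\rangle$ be a symplectic form on $S$ with $\langle v\cdot s,t\rangle=-\langle s,v\cdot t\rangle$ for all $v\in V$, $s,t\in S$. Put $\mathbb V=V\otimes\mathbb C$, $\mathbb S=S\otimes\mathbb C$ and extend all structures complex-linearly. For $\omega=\sum_i x_i\otimes y_i\in\odot^2\mathbb S$ and $q=1,2,5$ let $\omega^{(q)}\in\Lambda^q\mathbb V$ be the $q$-form $$\omega^{(q)}(v_1,\dots,v_q)=\sum_i\langle x_i,(v_1\wedge\cdots\wedge v_q)\cdot y_i\rangle ,$$ where vectors and covectors are identified by $\eta$, so that $\omega^{(1)}$ is the Dirac current of $\omega$. These components give the isomorphism $\odot^2\mathbb S\cong\Lambda^1\mathbb V\oplus\Lambda^2\mathbb V\oplus\Lambda^5\mathbb V$. The Dirac kernel of a subspace $\mathbb S'\subset\mathbb S$ is $\mathfrak D=\{\omega\in\odot^2\mathbb S' : \omega^{(1)}=0\}$. Let $s\in S$ have timelike Dirac current $\xi$,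 that is, $\xi\in V$ is defined by $\eta(\xi,v)=\langle s,v\cdot s\rangle$ for all $v\in V$, and $\eta(\xi,\xi)>0$. Put $W=\xi^\perp\subset V$ and $\mathbb W=W\otimes\mathbb C$, so that $\Lambda^n\mathbb V=\Lambda^n\mathbb W\oplus(\xi\wedge\Lambda^{n-1}\mathbb W)$. Let $J$ be the endomorphism of $V$ with $\eta(Jv,w)=\eta(\xi,\xi)^{-1/2}\,\langle s,(v\wedge w)\cdot s\rangle$; it is a complex structure on $W$. Let $\mathbb W=W^{10}\oplus W^{01}$ be the corresponding decomposition, where $W^{10}$ and $W^{01}$ are spanned by the vectors $\tfrac12(w-iJw)$ and $\tfrac12(w+iJw)$, $w\in W$, and let $\Lambda^{(p,q)}\subset\Lambda^{p+q}\mathbb W$ be the space of forms of type $(p,q)$. Let $\mathfrak D$ be the Dirac kernel of $\mathbb S'=(\mathbb C s)^\perp$, the symplectic orthogonal of $\mathbb C s$ in $\mathbb S$. Then: 1. for every $\theta\in\Lambda^{(2,0)}\oplus\Lambda^{(0,2)}\subset\Lambda^2\mathbb W$ there is $\omega\in\mathfrak D$ with $\omega^{(2)}=\theta$ and $\omega^{(5)}\in\xi\wedge\Lambda^4\mathbb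 W$; 2. for every $\theta\in\Lambda^{(4,1)}\oplus\Lambda^{(1,4)}\subset\Lambda^5\mathbb W$ there is $\omega\in\mathfrak D$ with $\omega^{(2)}\in\Lambda^2\mathbb W$ and $\omega^{(5)}-\theta\in\xi\wedge\Lambda^4\mathbb W$; 3. for every $\theta\in\Lambda^{(3,2)}\oplus\Lambda^{(2,3)}\subset\Lambda^5\mathbb W$ there is $\omega\in\mathfrak D$ with $\omega^{(2)}=0$ and $\omega^{(5)}-\theta\in\xi\wedge\Lambda^4\mathbb W$. -/

import Mathlib

open scoped TensorProduct

noncomputable section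

namespace ElevenDim

/-- A Lorentzian form of "mostly minus" signature `(1,10)`. -/
def IsLorentzian {V : Type*} [AddCommGroup V] [Module ℝ V] (η : LinearMap.BilinForm ℝ V) : Prop :=
  ∃ b : Module.Basis (Fin 11) ℝ V,
    ∀ i j, η (b i) (b j) = if i = j then (if i = 0 then 1 else -1) else 0

theorem IsLorentzian.finite {V : Type*} [AddCommGroup V] [Module ℝ V]
    {η : LinearMap.BilinForm ℝ V} (h : IsLorentzian η) : Module.Finite ℝ V :=
  let ⟨b, _⟩ := h
  Module.Finite.of_basis b

theorem IsLorentzian.nondegenerate {V : Type*} [AddCommGroup V] [Module ℝ V]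
    {η : LinearMap.BilinForm ℝ V} (h : IsLorentzian η) : η.Nondegenerate := by
  obtain ⟨b, hb⟩ := h
  have hs : ∀ x y, η x y = η y x := by
    have : η = η.flip := by
      refine b.ext fun i => b.ext fun j => ?_
      change η (b i) (b j) = η (b j) (b i)
      rw [hb, hb]
      by_cases hij : i = j
      · subst hij; rfl
      · rw [if_neg hij, if_neg (Ne.symm hij)]
    intro x y
    conv_lhs => rw [this]
    rfl
  have key : ∀ x, (∀ y, η x y = 0) → x = 0 := by
    intro x hx
    refine b.ext_elem fun j => ?_
    have h1 := hx (b j)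
    rw [← b.sum_repr x] at h1
    simp only [map_sum, map_smul, LinearMap.sum_apply, LinearMap.smul_apply, hb, smul_eq_mul,
      mul_ite, mul_one, mul_neg, mul_zero, Finset.sum_ite_eq', Finset.mem_univ, if_true] at h1
    by_cases hj : j = 0
    · simpa [hj] using h1
    · simpa [hj] using h1
  exact ⟨key, fun y hy => key y fun x => by rw [hs]; exact hy x⟩

/-- The algebraic data of eleven-dimensional supergravity: a Lorentzian vector space `(V, η)` of
signature `(1,10)`, an irreducible real module `S ≅ ℝ³²` of its Clifford algebra, with the
convention `v · v = - η(v,v)`, and a symplectic form `B = ⟨-,-⟩` on `S` for which Clifford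
multiplication by vectors is skew. (Every irreducible real module of this Clifford algebra has
dimension 32, so a module of dimension 32 is irreducible.) -/
structure SpinorData (V S : Type*) [AddCommGroup V] [Module ℝ V] [AddCommGroup S]
    [Module ℝ S] where
  /-- the Lorentzian inner product -/
  η : LinearMap.BilinForm ℝ V
  lorentzian : IsLorentzian η
  /-- the Clifford module structure of `S` -/
  ρ : CliffordAlgebra (-LinearMap.BilinMap.toQuadraticMap η) →ₐ[ℝ] Module.End ℝ S
  finrank_spinors : Module.finrank ℝ S = 32
  /-- the symplectic form -/
  B : LinearMap.BilinForm ℝ S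
  B_alt : B.IsAlt
  B_nondegenerate : B.Nondegenerate
  B_clifford : ∀ (v : V) (s t : S),
    B (ρ (CliffordAlgebra.ι (-LinearMap.BilinMap.toQuadraticMap η) v) s) t =
      - B s (ρ (CliffordAlgebra.ι (-LinearMap.BilinMap.toQuadraticMap η) v) t)

/-- The antisymmetrised product
`(v₁,…,v_q) ↦ (1/q!) ∑_σ sgn(σ) γ(v_σ(1)) ⋯ γ(v_σ(q))`. For Clifford multiplication `γ` this is
the Clifford action of the `q`-vector `v₁ ∧ ⋯ ∧ v_q` on spinors. -/
def wedgeAction {K E M : Type*} [Field K] [AddCommGroup E] [Module K E] [AddCommGroup M]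
    [Module K M] (γ : E →ₗ[K] Module.End K M) (q : ℕ) : E [⋀^Fin q]→ₗ[K] Module.End K M :=
  ((q.factorial : K)⁻¹) • MultilinearMap.alternatization
    ((MultilinearMap.mkPiAlgebraFin K q (Module.End K M)).compLinearMap fun _ => γ)

namespace SpinorData

variable {V S : Type*} [AddCommGroup V] [Module ℝ V] [AddCommGroup S] [Module ℝ S]
  (D : SpinorData V S)

/-- Clifford multiplication `v · s` by real vectors. -/
def γ : V →ₗ[ℝ] Module.End ℝ S :=
  D.ρ.toLinearMap ∘ₗ CliffordAlgebra.ι (-LinearMap.BilinMap.toQuadraticMap D.η)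

theorem γ_sq (v : V) : D.γ v * D.γ v = -(D.η v v) • (1 : Module.End ℝ S) := by
  have h := congrArg D.ρ
    (CliffordAlgebra.ι_sq_scalar (-LinearMap.BilinMap.toQuadraticMap D.η) v)
  rw [map_mul, AlgHom.commutes, Algebra.algebraMap_eq_smul_one] at h
  simpa [γ] using h

/-- The musical isomorphism `V* ≃ V`. -/
def sharp : Module.Dual ℝ V ≃ₗ[ℝ] V :=
  haveI := D.lorentzian.finite
  (D.η.toDual D.lorentzian.nondegenerate).symm

theorem η_sharp (f : Module.Dual ℝ V) (v : V) : D.η (D.sharp f) v = f v := by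
  have := D.lorentzian.finite
  exact LinearMap.BilinForm.apply_toDual_symm_apply f v

/-- The Dirac current `κ(s,t)`, defined by `η(κ(s,t), v) = ⟨s, v · t⟩`. -/
def diracCurrent (s t : S) : V := D.sharp (D.B s ∘ₗ D.γ.flip t)

theorem η_diracCurrent (s t : S) (v : V) : D.η (D.diracCurrent s t) v = D.B s (D.γ v t) := by
  rw [diracCurrent, η_sharp]; rfl

/-- The real `q`-form `Ω^(q)(v₁,…,v_q) = ⟨s, (v₁ ∧ ⋯ ∧ v_q) · s⟩` of a spinor `s`. -/
def spinorForm (q : ℕ) (s : S) : V [⋀^Fin q]→ₗ[ℝ] ℝ :=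
  (D.B s ∘ₗ LinearMap.applyₗ s).compAlternatingMap (wedgeAction D.γ q)

/-- The endomorphism `J` of `V` determined by the two-form of a spinor `s` with timelike Dirac
current `ξ`, rescaled so as not to depend on the length of `s`:
`η(J v, w) = η(ξ,ξ)^(-1/2) Ω^(2)(v,w)`. It kills `ξ` and is a complex structure on `W = ξ^⊥`. If `s`
is normalised by `η(ξ,ξ) = 1`, it is `Ω^(2)` regarded as an endomorphism. -/
def complexStructure (s : S) (v : V) : V :=
  (Real.sqrt (D.η (D.diracCurrent s s) (D.diracCurrent s s)))⁻¹ •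
    D.sharp ((AlternatingMap.ofSubsingleton ℝ V ℝ (0 : Fin 1)).symm
      ((D.spinorForm 2 s).curryLeft v))

theorem η_complexStructure (s : S) (v w : V) : D.η (D.complexStructure s v) w =
    (Real.sqrt (D.η (D.diracCurrent s s) (D.diracCurrent s s)))⁻¹ *
      D.spinorForm 2 s ![v, w] := by
  rw [complexStructure, map_smul, LinearMap.smul_apply, η_sharp, smul_eq_mul]
  simp only [AlternatingMap.ofSubsingleton_symm_apply_apply, AlternatingMap.curryLeft_apply_apply]
  rfl

/-! ### Complexification -/

/-- Clifford multiplication of the complexified vectors on the Dirac spinors `ℂ ⊗ S`. -/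
def γC : (ℂ ⊗[ℝ] V) →ₗ[ℂ] Module.End ℂ (ℂ ⊗[ℝ] S) :=
  LinearMap.liftBaseChange ℂ ((Module.End.baseChangeHom ℝ ℂ S).toLinearMap ∘ₗ D.γ)

/-- The complex-bilinear extension of the symplectic form. -/
def BC : LinearMap.BilinForm ℂ (ℂ ⊗[ℝ] S) := D.B.baseChange ℂ

/-- For a bispinor `ω = ∑ xᵢ ⊗ yᵢ` and an endomorphism `A` of the Dirac spinors, the number
`∑ ⟨xᵢ, A yᵢ⟩`. -/
def bispinorPairing (ω : (ℂ ⊗[ℝ] S) ⊗[ℂ] (ℂ ⊗[ℝ] S)) :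
    Module.End ℂ (ℂ ⊗[ℝ] S) →ₗ[ℂ] ℂ :=
  TensorProduct.lift D.BC ∘ₗ LinearMap.applyₗ ω ∘ₗ LinearMap.lTensorHom (ℂ ⊗[ℝ] S)

theorem bispinorPairing_tmul (x y : ℂ ⊗[ℝ] S) (A : Module.End ℂ (ℂ ⊗[ℝ] S)) :
    D.bispinorPairing (x ⊗ₜ y) A = D.BC x (A y) := rfl

/-- The component `ω^(q)` of a bispinor `ω = ∑ xᵢ ⊗ yᵢ`, as a `q`-form on `ℂ ⊗ V`:
`ω^(q)(v₁,…,v_q) = ∑ ⟨xᵢ, (v₁ ∧ ⋯ ∧ v_q) · yᵢ⟩`. -/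
def component (q : ℕ) (ω : (ℂ ⊗[ℝ] S) ⊗[ℂ] (ℂ ⊗[ℝ] S)) : (ℂ ⊗[ℝ] V) [⋀^Fin q]→ₗ[ℂ] ℂ :=
  (D.bispinorPairing ω).compAlternatingMap (wedgeAction D.γC q)

/-- The symmetric square `⊙² N` of a space `N` of Dirac spinors, as symmetric tensors. -/
def symSquare (N : Submodule ℂ (ℂ ⊗[ℝ] S)) : Submodule ℂ ((ℂ ⊗[ℝ] S) ⊗[ℂ] (ℂ ⊗[ℝ] S)) :=
  Submodule.span ℂ {ω | ∃ t ∈ N, ω = t ⊗ₜ[ℂ] t}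

/-- The Dirac kernel of a space `N` of Dirac spinors: the elements of `⊙² N` with vanishing Dirac
current `ω^(1)`. -/
def diracKernel (N : Submodule ℂ (ℂ ⊗[ℝ] S)) :
    Submodule ℂ ((ℂ ⊗[ℝ] S) ⊗[ℂ] (ℂ ⊗[ℝ] S)) where
  carrier := {ω | ω ∈ symSquare N ∧ D.component 1 ω = 0}
  add_mem' := by
    rintro a b ⟨ha, ha'⟩ ⟨hb, hb'⟩
    refine ⟨add_mem ha hb, ?_⟩
    have : D.component 1 (a + b) = D.component 1 a + D.component 1 b := by
      ext v
      simp [component, bispinorPairing]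
    rw [this, ha', hb', add_zero]
  zero_mem' := by
    refine ⟨zero_mem _, ?_⟩
    ext v
    simp [component, bispinorPairing]
  smul_mem' := by
    rintro c a ⟨ha, ha'⟩
    refine ⟨Submodule.smul_mem _ c ha, ?_⟩
    have : D.component 1 (c • a) = c • D.component 1 a := by
      ext v
      simp [component, bispinorPairing]
    rw [this, ha', smul_zero]

/-- The symplectic orthogonal `(ℂ s)^⊥` in the Dirac spinors of the line spanned by the real
spinor `s`. -/
def orthogonalOfSpinor (s : S) : Submodule ℂ (ℂ ⊗[ℝ] S) :=
  LinearMap.BilinForm.orthogonal D.BC (ℂ ∙ ((1 : ℂ) ⊗ₜ[ℝ] s))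

/-- `W¹⁰`, spanned by the vectors `(w - i J w)/2` with `w ∈ W = ξ^⊥`. -/
def W10 (s : S) : Submodule ℂ (ℂ ⊗[ℝ] V) :=
  Submodule.span ℂ {u | ∃ w : V, D.η (D.diracCurrent s s) w = 0 ∧
    u = (1 / 2 : ℂ) • ((1 : ℂ) ⊗ₜ[ℝ] w - Complex.I ⊗ₜ[ℝ] D.complexStructure s w)}

/-- `W⁰¹`, the conjugate of `W¹⁰`. -/
def W01 (s : S) : Submodule ℂ (ℂ ⊗[ℝ] V) :=
  Submodule.span ℂ {u | ∃ w : V, D.η (D.diracCurrent s s) w = 0 ∧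
    u = (1 / 2 : ℂ) • ((1 : ℂ) ⊗ₜ[ℝ] w + Complex.I ⊗ₜ[ℝ] D.complexStructure s w)}

/-- `Λⁿ 𝕎 ⊂ Λⁿ 𝕍`: the `n`-forms annihilated by contraction with `ξ`. -/
def formsW (s : S) (n : ℕ) : Submodule ℂ ((ℂ ⊗[ℝ] V) [⋀^Fin n]→ₗ[ℂ] ℂ) where
  carrier := {θ | ∀ v : Fin n → ℂ ⊗[ℝ] V,
    (∃ i, v i = (1 : ℂ) ⊗ₜ[ℝ] D.diracCurrent s s) → θ v = 0}
  add_mem' := fun ha hb v hv => by simp [ha v hv, hb v hv]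
  zero_mem' := fun _ _ => rfl
  smul_mem' := fun c _ ha v hv => by simp [ha v hv]

/-- `ξ ∧ Λⁿ⁻¹ 𝕎 ⊂ Λⁿ 𝕍`: the `n`-forms whose restriction to `𝕎 = ℂ ⊗ ξ^⊥` is zero. Via `ξ ∧ -` this
is the copy of `Λⁿ⁻¹ 𝕎` in `Λⁿ 𝕍 = Λⁿ 𝕎 ⊕ (ξ ∧ Λⁿ⁻¹ 𝕎)`. -/
def formsXiW (s : S) (n : ℕ) : Submodule ℂ ((ℂ ⊗[ℝ] V) [⋀^Fin n]→ₗ[ℂ] ℂ) where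
  carrier := {θ | ∀ w : Fin n → V, (∀ i, D.η (D.diracCurrent s s) (w i) = 0) →
    θ (fun i => (1 : ℂ) ⊗ₜ[ℝ] w i) = 0}
  add_mem' := fun ha hb v hv => by simp [ha v hv, hb v hv]
  zero_mem' := fun _ _ => rfl
  smul_mem' := fun c _ ha v hv => by simp [ha v hv]

/-- `Λ^(p,q) ⊂ Λⁿ 𝕎`, where `n = p + q`: the forms that vanish on every family of vectors each of
which is in `W¹⁰` or in `W⁰¹`, unless `p` of them are in `W¹⁰` and `q` of them in `W⁰¹`. -/
def formsType (s : S) (n p q : ℕ) : Submodule ℂ ((ℂ ⊗[ℝ] V) [⋀^Fin n]→ₗ[ℂ] ℂ) where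
  carrier := {θ | θ ∈ D.formsW s n ∧ ∀ A : Finset (Fin n), ¬ (A.card = p ∧ Aᶜ.card = q) →
    ∀ v : Fin n → ℂ ⊗[ℝ] V, (∀ i ∈ A, v i ∈ D.W10 s) → (∀ i ∉ A, v i ∈ D.W01 s) → θ v = 0}
  add_mem' := fun ha hb => ⟨add_mem ha.1 hb.1, fun A hA v h1 h2 => by
    simp [ha.2 A hA v h1 h2, hb.2 A hA v h1 h2]⟩
  zero_mem' := ⟨zero_mem _, fun _ _ _ _ _ => rfl⟩
  smul_mem' := fun c _ ha => ⟨Submodule.smul_mem _ c ha.1, fun A hA v h1 h2 => by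
    simp [ha.2 A hA v h1 h2]⟩

end SpinorData

end ElevenDim

end

/-!
Write `ξ` for the Dirac current of `s`, `ξ̂` for its normalisation and `W = ξ^⊥`. The proof rests on
two facts.

The first is that `s` is the sum of two opposite pure spinors. Averaging over the Clifford words
(`sum_conjSet`, a form of Schur's lemma) gives Fierz identities, and a suitable combination of them,
in which the contributions of rank five cancel, is the identity `(ι_v Ω⁽²⁾) · s = (ξ ∧ v) · s` of
`fierz_two_form`. For `w ∈ W` it reads `J w · s = ξ̂ · w · s`. Hence the eigencomponents
`z = (s - i ξ̂ · s)/2` and `z' = (s + i ξ̂ · s)/2` of `ξ̂` are annihilated by `W¹⁰` and `W⁰¹`, so that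
the Dirac spinors are filtered by the number of vectors from `W⁰¹` applied to `z`; this is packaged
as a `Polarization`. Moreover `z` pairs trivially with `n · z` for `n ∈ W`.

The second is that the Clifford endomorphism `X` of a form `θ` of degree `q = 1`, `2` or `5`
(`endOfForm`) lies in the symplectic Lie algebra, hence comes from a symmetric bispinor, and that
the components of this bispinor are the traces `tr (γ(v₁ ∧ ⋯ ∧ v_k) X)`, that is `θ` in the degree
of `θ` and zero in the other two. If `θ` has type `(r, q - r)`, then `X` is a combination of
products of `r` vectors from `W⁰¹` and `q - r` vectors from `W¹⁰` (`endOfForm_mem_span`); thus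
`X z' = 0` for `2 r > q`, and `X z` is in level `2 r - q` of the filtration.

The bispinor of `X` need not be in `⊙² (ℂ s)^⊥`, and it is projected there along `z` in degree five
and along `z'` in degree two. By `exists_bispinor` this adds to the component in degree `k` a
multiple of `⟨y, γ(v₁ ∧ ⋯ ∧ v_k) X z⟩`, where `y` is `z` or `z'`. These pairings vanish where they
have to, by the eigenvalues of `ξ̂` and by the filtration. The exception is the component in degree
two of a `(2, 0)`-form, where the correction is `-θ/4`, so that `3 θ/4` is left.
-/

open scoped TensorProduct

noncomputable section

namespace ElevenDim


/-! ### Clifford modules with an orthonormal basis -/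

/-- A 32-dimensional module of the Clifford algebra of an eleven-dimensional quadratic space over
a field `K`, with an invariant symplectic form. The orthonormal basis `b`, with squares `ε i = ±1`,
is part of the data; over `ℝ` it is given by the Lorentzian signature, and over `ℂ` it is the
complexified real basis. -/
structure CliffordSpinors (K E M : Type*) [Field K] [AddCommGroup E] [Module K E]
    [AddCommGroup M] [Module K M] where
  /-- the inner product of vectors -/
  η : LinearMap.BilinForm K E
  /-- Clifford multiplication -/
  γ : E →ₗ[K] Module.End K M
  /-- the symplectic form on spinors -/
  B : LinearMap.BilinForm K M
  /-- an orthonormal basis -/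
  b : Module.Basis (Fin 11) K E
  /-- the squares of the basis vectors -/
  ε : Fin 11 → K
  ε_sq : ∀ i, ε i * ε i = 1
  η_basis : ∀ i j, η (b i) (b j) = if i = j then ε i else 0
  η_symm : ∀ v w, η v w = η w v
  clifford : ∀ v w, γ v * γ w + γ w * γ v = -(2 * η v w) • (1 : Module.End K M)
  finrank_eq : Module.finrank K M = 32
  B_swap : ∀ x y, B x y = -B y x
  B_nondegenerate : B.Nondegenerate
  B_clifford : ∀ v x y, B (γ v x) y = -B x (γ v y)

namespace CliffordSpinors

set_option linter.unusedSectionVars false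

variable {K E M : Type*} [Field K] [CharZero K] [AddCommGroup E] [Module K E]
  [AddCommGroup M] [Module K M] (C : CliffordSpinors K E M)

theorem finite (C : CliffordSpinors K E M) : Module.Finite K M :=
  Module.finite_of_finrank_pos (by rw [C.finrank_eq]; norm_num)

theorem clifford_apply (v w : E) (x : M) :
    C.γ v (C.γ w x) = -C.γ w (C.γ v x) - (2 * C.η v w) • x := by
  have := congrArg (fun f : Module.End K M => f x) (C.clifford v w)
  simp only [LinearMap.add_apply, Module.End.mul_apply, neg_smul, LinearMap.neg_apply,
    LinearMap.smul_apply, Module.End.one_apply] at this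
  rw [eq_sub_iff_add_eq, ← sub_eq_zero, ← sub_eq_zero.mpr this]
  abel

theorem clifford_sq (v : E) : C.γ v * C.γ v = -(C.η v v) • (1 : Module.End K M) := by
  have h := C.clifford v v
  have h2 : (2 : K) • (C.γ v * C.γ v) = (2 : K) • (-(C.η v v) • (1 : Module.End K M)) := by
    rw [two_smul, h, smul_smul]; congr 1; ring
  exact smul_right_injective _ (two_ne_zero (α := K)) h2

theorem B_self (x : M) : C.B x x = 0 := by
  have h := C.B_swap x x
  exact self_eq_neg.mp h

/-- Expansion of a vector in the orthonormal basis. -/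
theorem sum_basis (v : E) : ∑ i, (C.ε i * C.η v (C.b i)) • C.b i = v := by
  have h : ∀ i, C.ε i * C.η v (C.b i) = C.b.repr v i := by
    intro i
    conv_lhs => rw [← C.b.sum_repr v]
    simp only [map_sum, map_smul, LinearMap.sum_apply, LinearMap.smul_apply, C.η_basis,
      smul_eq_mul, mul_ite, mul_zero, Finset.sum_ite_eq', Finset.mem_univ, if_true]
    rw [mul_comm, mul_assoc, C.ε_sq, mul_one]
  simp_rw [h]
  exact C.b.sum_repr v

theorem eq_zero_of_η (v : E) (h : ∀ w, C.η v w = 0) : v = 0 := by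
  rw [← C.sum_basis v]
  simp [h]

/-! ### Clifford words -/

/-- Clifford multiplication by the `i`-th vector of the orthonormal basis. -/
def g (i : Fin 11) : Module.End K M := C.γ (C.b i)

theorem g_sq (i : Fin 11) : C.g i * C.g i = (-C.ε i) • (1 : Module.End K M) := by
  have := C.clifford_sq (C.b i)
  rwa [C.η_basis, if_pos rfl] at this

theorem g_anticomm {i j : Fin 11} (h : i ≠ j) : C.g i * C.g j = -(C.g j * C.g i) := by
  have := C.clifford (C.b i) (C.b j)
  rw [C.η_basis, if_neg h, mul_zero, neg_zero, zero_smul] at this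
  exact eq_neg_of_add_eq_zero_left this

/-- The Clifford product of the basis vectors named by a list of indices. -/
def word (l : List (Fin 11)) : Module.End K M := (l.map C.g).prod

@[simp] theorem word_nil : C.word [] = 1 := rfl

@[simp] theorem word_cons (i : Fin 11) (l : List (Fin 11)) :
    C.word (i :: l) = C.g i * C.word l := by simp [word]

@[simp] theorem word_append (l l' : List (Fin 11)) :
    C.word (l ++ l') = C.word l * C.word l' := by simp [word]

theorem g_mul_word (i : Fin 11) (l : List (Fin 11)) :
    C.g i * C.word l = (-1 : K) ^ (l.length + l.count i) • (C.word l * C.g i) := by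
  induction l with
  | nil => simp
  | cons j l ih =>
    rw [word_cons]
    by_cases h : j = i
    · subst h
      rw [List.count_cons_self, List.length_cons, ih, ← add_assoc, pow_succ,
        add_right_comm, pow_succ]
      simp [mul_assoc, ← ih]
      rw [ih]
      simp
    · rw [List.count_cons_of_ne h, List.length_cons, ← mul_assoc,
        C.g_anticomm (Ne.symm h), neg_mul, mul_assoc, ih, add_right_comm, pow_succ]
      simp [mul_assoc]

/-- Up to a scalar, the reversed word is the inverse. -/
theorem word_mul_word_reverse (l : List (Fin 11)) :
    C.word l * C.word l.reverse = (l.map fun i => -C.ε i).prod • (1 : Module.End K M) := by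
  induction l with
  | nil => simp
  | cons i l ih =>
    rw [List.reverse_cons, word_append, word_cons, word_cons, word_nil, mul_one,
      ← mul_assoc, mul_assoc (C.g i), ih, mul_smul_comm, mul_one, smul_mul_assoc, C.g_sq,
      smul_smul, List.map_cons, List.prod_cons, mul_comm]

theorem word_reverse {l : List (Fin 11)} (hl : l.Nodup) :
    C.word l.reverse = (-1 : K) ^ (l.length * (l.length - 1) / 2) • C.word l := by
  induction l with
  | nil => simp
  | cons i l ih =>
    rw [List.nodup_cons] at hl
    have h := C.g_mul_word i l
    rw [List.count_eq_zero_of_not_mem hl.1, add_zero] at h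
    have h' : C.word l * C.g i = (-1 : K) ^ l.length • (C.g i * C.word l) := by
      rw [h, smul_smul, ← pow_add, Even.neg_one_pow ⟨_, rfl⟩, one_smul]
    rw [List.reverse_cons, word_append, ih hl.2, word_cons, word_cons, word_nil, mul_one,
      smul_mul_assoc, h', smul_smul, ← pow_add, List.length_cons]
    congr 2
    rw [← Finset.sum_range_id, ← Finset.sum_range_id, Finset.sum_range_succ]

theorem word_adjoint (l : List (Fin 11)) (x y : M) :
    C.B (C.word l x) y = (-1 : K) ^ l.length * C.B x (C.word l.reverse y) := by
  induction l generalizing y with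
  | nil => simp
  | cons i l ih =>
    rw [word_cons, Module.End.mul_apply, g, C.B_clifford, ih, List.reverse_cons, word_append,
      List.length_cons, pow_succ]
    simp [g]

/-- In ranks `1, 2` modulo `4` the Clifford words are skew for the symplectic form. -/
theorem word_skew {l : List (Fin 11)} (hl : l.Nodup) (x y : M) :
    C.B (C.word l x) y =
      (-1 : K) ^ (l.length * (l.length + 1) / 2) * C.B x (C.word l y) := by
  rw [C.word_adjoint, C.word_reverse hl, LinearMap.smul_apply, map_smul, smul_eq_mul, ← mul_assoc,
    ← pow_add]
  congr 2
  have h := Finset.sum_range_id (l.length + 1)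
  rw [Finset.sum_range_succ, Finset.sum_range_id, Nat.add_sub_cancel] at h
  rw [add_comm, h, mul_comm]

/-! ### Traces of Clifford words -/

theorem trace_mul_g (i : Fin 11) (X : Module.End K M) :
    LinearMap.trace K M (C.g i * X * C.g i) = -C.ε i * LinearMap.trace K M X := by
  rw [LinearMap.trace_mul_comm, ← mul_assoc, C.g_sq, smul_mul_assoc, one_mul, map_smul,
    smul_eq_mul]

theorem ε_ne_zero (i : Fin 11) : C.ε i ≠ 0 := fun h => by
  have := C.ε_sq i
  simp [h] at this

theorem trace_word_eq_zero {l : List (Fin 11)} (i : Fin 11) (h : Odd (l.length + l.count i)) :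
    LinearMap.trace K M (C.word l) = 0 := by
  have h1 := C.trace_mul_g i (C.word l)
  rw [C.g_mul_word, h.neg_one_pow, smul_mul_assoc, mul_assoc, C.g_sq, mul_smul_comm, mul_one,
    map_smul, map_smul, smul_eq_mul, smul_eq_mul] at h1
  have h2 : (2 * C.ε i) * LinearMap.trace K M (C.word l) = 0 := by linear_combination h1
  exact (mul_eq_zero.mp h2).resolve_left (mul_ne_zero two_ne_zero (C.ε_ne_zero i))

/-- Two different Clifford words without repetition are orthogonal for the trace form, provided
that they do not together exhaust the eleven basis vectors. -/
theorem trace_word_mul_word_eq_zero {l l' : List (Fin 11)} (hl : l.Nodup) (hl' : l'.Nodup)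
    (hne : l.toFinset ≠ l'.toFinset) {k : Fin 11} (hk : k ∉ l) (hk' : k ∉ l') :
    LinearMap.trace K M (C.word l * C.word l') = 0 := by
  rw [← word_append]
  rcases Nat.even_or_odd (l ++ l').length with he | ho
  · obtain ⟨i, hi⟩ : ∃ i, ¬ (i ∈ l ↔ i ∈ l') := by
      by_contra! hcon
      exact hne (by ext i; simpa using hcon i)
    refine C.trace_word_eq_zero i (he.add_odd ?_)
    rw [List.count_append]
    by_cases h1 : i ∈ l
    · have h2 : i ∉ l' := fun h2 => hi ⟨fun _ => h2, fun _ => h1⟩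
      rw [List.count_eq_one_of_mem hl h1, List.count_eq_zero_of_not_mem h2]
      exact odd_one
    · have h2 : i ∈ l' := by by_contra h2; exact hi ⟨fun h => absurd h h1, fun h => absurd h h2⟩
      rw [List.count_eq_one_of_mem hl' h2, List.count_eq_zero_of_not_mem h1]
      exact odd_one
  · refine C.trace_word_eq_zero k (ho.add_even ?_)
    rw [List.count_append, List.count_eq_zero_of_not_mem hk, List.count_eq_zero_of_not_mem hk']
    exact Even.zero

theorem trace_one (C : CliffordSpinors K E M) :
    LinearMap.trace K M (1 : Module.End K M) = 32 := by
  have := C.finite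
  rw [LinearMap.trace_one, C.finrank_eq]; norm_num

/-- The `1024 = 32²` Clifford words in the first ten basis vectors span the endomorphisms. -/
theorem span_word : Submodule.span K (Set.range C.word) = ⊤ := by
  have := C.finite
  let L : Finset (Fin 10) → List (Fin 11) := fun A => A.toList.map Fin.castSucc
  have hnd : ∀ A, (L A).Nodup := fun A =>
    (Finset.nodup_toList A).map (Fin.castSucc_injective 10)
  have hlast : ∀ A, Fin.last 10 ∉ L A := by
    intro A h
    obtain ⟨i, -, hi⟩ := List.mem_map.mp h
    exact absurd hi (Fin.castSucc_lt_last i).ne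
  have hinj : ∀ A A', (L A).toFinset = (L A').toFinset → A = A' := by
    intro A A' h
    ext i
    have := Finset.ext_iff.mp h i.castSucc
    simpa [L] using this
  have hli : LinearIndependent K fun A => C.word (L A) := by
    rw [Fintype.linearIndependent_iff]
    intro c hc A
    have h := congrArg (fun X => LinearMap.trace K M (X * C.word (L A).reverse)) hc
    simp only [Finset.sum_mul, map_sum, smul_mul_assoc, map_smul, zero_mul, map_zero,
      smul_eq_mul] at h
    rw [Finset.sum_eq_single A, C.word_mul_word_reverse, map_smul, C.trace_one, smul_eq_mul] at h
    · refine (mul_eq_zero.mp h).resolve_right (mul_ne_zero ?_ (by norm_num))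
      refine List.prod_ne_zero ?_
      intro h0
      obtain ⟨i, -, hi⟩ := List.mem_map.mp h0
      exact C.ε_ne_zero i (neg_eq_zero.mp hi)
    · intro A' _ hA'
      rw [C.trace_word_mul_word_eq_zero (hnd A') (List.nodup_reverse.mpr (hnd A))
        (by rw [List.toFinset_reverse]; exact fun h => hA' (hinj _ _ h)) (hlast A')
        (by rw [List.mem_reverse]; exact hlast A), mul_zero]
    · simp
  have htop := hli.span_eq_top_of_card_eq_finrank (by
    rw [Fintype.card_finset, Fintype.card_fin, Module.finrank_linearMap, C.finrank_eq]; norm_num)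
  rw [eq_top_iff, ← htop]
  refine Submodule.span_mono ?_
  rintro _ ⟨A, rfl⟩
  exact ⟨_, rfl⟩

/-- The commutant of the Clifford action consists of the scalars. -/
theorem eq_smul_one_of_commute {Y : Module.End K M} (h : ∀ i, C.g i * Y = Y * C.g i) :
    ∃ c : K, Y = c • (1 : Module.End K M) := by
  have := C.finite
  have hw : ∀ l, C.word l * Y = Y * C.word l := by
    intro l
    induction l with
    | nil => simp
    | cons i l ih => rw [word_cons, mul_assoc, ih, ← mul_assoc, h, mul_assoc]
  have hall : ∀ X : Module.End K M, X * Y = Y * X := by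
    intro X
    have hX : X ∈ Submodule.span K (Set.range C.word) := by rw [C.span_word]; trivial
    induction hX using Submodule.span_induction with
    | mem x hx => obtain ⟨l, rfl⟩ := hx; exact hw l
    | zero => simp
    | add x y _ _ hx hy => rw [add_mul, mul_add, hx, hy]
    | smul c x _ hx => rw [smul_mul_assoc, mul_smul_comm, hx]
  have hc : Y ∈ Subalgebra.center K (Module.End K M) :=
    Subalgebra.mem_center_iff.mpr hall
  rw [Algebra.IsCentral.center_eq_bot] at hc
  obtain ⟨c, hc⟩ := Algebra.mem_bot.mp hc
  exact ⟨c, by rw [← hc, Algebra.algebraMap_eq_smul_one]⟩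

/-! ### Averaging over the Clifford group -/

/-- Conjugation of endomorphisms by the `i`-th basis vector. -/
def conj (i : Fin 11) : Module.End K (Module.End K M) :=
  (-C.ε i) • (LinearMap.mulLeft K (C.g i) ∘ₗ LinearMap.mulRight K (C.g i))

theorem conj_apply (i : Fin 11) (X : Module.End K M) :
    C.conj i X = (-C.ε i) • (C.g i * (X * C.g i)) := rfl

theorem conj_mul_self (i : Fin 11) : C.conj i * C.conj i = 1 := by
  ext1 X
  rw [Module.End.mul_apply, conj_apply, conj_apply, Module.End.one_apply]
  rw [smul_mul_assoc, mul_smul_comm, smul_smul, mul_assoc, mul_assoc, C.g_sq, mul_smul_comm,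
    mul_smul_comm, mul_smul_comm, ← mul_assoc, C.g_sq, smul_mul_assoc, smul_smul, smul_smul,
    mul_one, one_mul]
  have := C.ε_sq i
  rw [show -C.ε i * -C.ε i * -C.ε i * -C.ε i = (C.ε i * C.ε i) * (C.ε i * C.ε i) by ring, this,
    one_mul, one_smul]

theorem conj_commute (i j : Fin 11) : Commute (C.conj i) (C.conj j) := by
  rcases eq_or_ne i j with rfl | h
  · exact Commute.refl _
  · ext1 X
    simp only [Module.End.mul_apply, conj_apply, smul_mul_assoc, mul_smul_comm]
    rw [smul_comm]
    congr 2
    have h1 : C.g i * (C.g j * (X * C.g j) * C.g i) = C.g i * C.g j * X * (C.g j * C.g i) := by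
      simp only [mul_assoc]
    have h2 : C.g j * (C.g i * (X * C.g i) * C.g j) = C.g j * C.g i * X * (C.g i * C.g j) := by
      simp only [mul_assoc]
    rw [h1, h2, C.g_anticomm h, neg_mul, neg_mul, mul_neg]

/-- Conjugation by the Clifford product of the basis vectors with index in `A`. -/
def conjSet (A : Finset (Fin 11)) : Module.End K (Module.End K M) :=
  (A.toList.map C.conj).prod

theorem conjSet_insert {i : Fin 11} {A : Finset (Fin 11)} (h : i ∉ A) :
    C.conjSet (insert i A) = C.conj i * C.conjSet A := by
  have hp := (Finset.toList_insert h).map C.conj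
  rw [conjSet, List.Perm.prod_eq' hp, List.map_cons, List.prod_cons, conjSet]
  rw [List.pairwise_map]
  exact List.pairwise_of_forall fun i j => C.conj_commute i j

@[simp] theorem conjSet_empty : C.conjSet ∅ = 1 := by simp [conjSet]

theorem conjSet_singleton (i : Fin 11) : C.conjSet {i} = C.conj i := by simp [conjSet]

theorem conjSet_symmDiff_singleton (i : Fin 11) (A : Finset (Fin 11)) :
    C.conjSet (symmDiff {i} A) = C.conj i * C.conjSet A := by
  by_cases h : i ∈ A
  · have h1 : symmDiff {i} A = A.erase i := by
      ext j; by_cases hj : j = i <;> simp [Finset.mem_symmDiff, hj, h]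
    have h2 := C.conjSet_insert (Finset.notMem_erase i A)
    rw [Finset.insert_erase h] at h2
    rw [h1, h2, ← mul_assoc, conj_mul_self, one_mul]
  · have h1 : symmDiff {i} A = insert i A := by
      ext j
      by_cases hj : j = i
      · simp [Finset.mem_symmDiff, hj, h]
      · simp [Finset.mem_symmDiff, hj]
    rw [h1, C.conjSet_insert h]

theorem conjSet_symmDiff (A A' : Finset (Fin 11)) :
    C.conjSet (symmDiff A A') = C.conjSet A * C.conjSet A' := by
  induction A using Finset.induction_on with
  | empty => rw [← Finset.bot_eq_empty, bot_symmDiff, Finset.bot_eq_empty, conjSet_empty, one_mul]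
  | insert i A hi ih =>
    have h1 : insert i A = symmDiff {i} A := by
      ext j
      by_cases hj : j = i
      · simp [Finset.mem_symmDiff, hj, hi]
      · simp [Finset.mem_symmDiff, hj]
    rw [C.conjSet_insert hi, h1, symmDiff_assoc, C.conjSet_symmDiff_singleton, ih, mul_assoc]

theorem trace_conjSet (A : Finset (Fin 11)) (X : Module.End K M) :
    LinearMap.trace K M (C.conjSet A X) = LinearMap.trace K M X := by
  induction A using Finset.induction_on with
  | empty => simp
  | insert i A hi ih =>
    rw [C.conjSet_insert hi, Module.End.mul_apply, conj_apply, ← mul_assoc, map_smul,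
      C.trace_mul_g, smul_eq_mul, ih, ← mul_assoc, neg_mul_neg, C.ε_sq, one_mul]

/-- Schur's lemma in averaged form: the sum of the conjugates of an endomorphism by the `2¹¹`
Clifford words is a scalar. -/
theorem sum_conjSet (X : Module.End K M) :
    ∑ A, C.conjSet A X = (64 * LinearMap.trace K M X) • (1 : Module.End K M) := by
  set Y := ∑ A, C.conjSet A X with hY
  have h1 : ∀ i, C.conj i Y = Y := by
    intro i
    rw [hY, map_sum]
    simp_rw [← Module.End.mul_apply, ← C.conjSet_symmDiff_singleton]
    have hinv : Function.Involutive fun A : Finset (Fin 11) => symmDiff {i} A := fun A =>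
      symmDiff_symmDiff_cancel_left _ _
    exact Equiv.sum_comp hinv.toPerm (fun A => C.conjSet A X)
  have h2 : ∀ i, C.g i * Y = Y * C.g i := by
    intro i
    conv_rhs => rw [← h1 i, conj_apply]
    rw [smul_mul_assoc, mul_assoc, mul_assoc, C.g_sq, mul_smul_comm, mul_smul_comm, smul_smul,
      neg_mul_neg, C.ε_sq, one_smul, mul_one]
  obtain ⟨c, hc⟩ := C.eq_smul_one_of_commute h2
  have h3 : LinearMap.trace K M Y = 2048 * LinearMap.trace K M X := by
    rw [hY, map_sum]
    simp only [C.trace_conjSet, Finset.sum_const, Finset.card_univ, Fintype.card_finset,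
      Fintype.card_fin, nsmul_eq_mul]
    norm_num
  rw [hc, map_smul, C.trace_one, smul_eq_mul] at h3
  rw [hc]
  congr 1
  have : (32 : K) * (c - 64 * LinearMap.trace K M X) = 0 := by linear_combination h3
  exact sub_eq_zero.mp ((mul_eq_zero.mp this).resolve_left (by norm_num))

theorem prod_conj_apply (l : List (Fin 11)) (X : Module.End K M) :
    (l.map C.conj).prod X =
      (l.map fun i => -C.ε i).prod • (C.word l * (X * C.word l.reverse)) := by
  induction l with
  | nil => simp
  | cons i l ih =>
    rw [List.map_cons, List.prod_cons, Module.End.mul_apply, ih, map_smul, conj_apply,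
      List.map_cons, List.prod_cons, smul_smul, mul_comm, word_cons, List.reverse_cons,
      word_append, word_cons, word_nil, mul_one]
    simp only [mul_assoc]

theorem prod_conj_g_mul (l : List (Fin 11)) (a : Fin 11) (X : Module.End K M) :
    (l.map C.conj).prod (C.g a * X) =
      (-1 : K) ^ (l.length + l.count a) • (C.g a * (l.map C.conj).prod X) := by
  have h := C.g_mul_word a l
  have h' : C.word l * C.g a = (-1 : K) ^ (l.length + l.count a) • (C.g a * C.word l) := by
    rw [h, smul_smul, ← pow_add, Even.neg_one_pow ⟨_, rfl⟩, one_smul]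
  rw [C.prod_conj_apply, C.prod_conj_apply, mul_assoc (C.g a), ← mul_assoc (C.word l), h',
    smul_mul_assoc, smul_comm, mul_smul_comm, mul_assoc]

/-- The product of all eleven basis vectors is central. -/
theorem conjSet_univ : C.conjSet Finset.univ = 1 := by
  set l := (Finset.univ : Finset (Fin 11)).toList with hl
  have hnd : l.Nodup := Finset.nodup_toList _
  have hlen : l.length = 11 := by rw [hl, Finset.length_toList]; rfl
  have hcomm : ∀ i, C.g i * C.word l = C.word l * C.g i := by
    intro i
    rw [C.g_mul_word, List.count_eq_one_of_mem hnd (by simp [hl]), hlen]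
    norm_num
  obtain ⟨c, hc⟩ := C.eq_smul_one_of_commute hcomm
  obtain ⟨k, hk⟩ : ∃ k : K, ∀ X, C.conjSet Finset.univ X = k • X := by
    refine ⟨(l.map fun i => -C.ε i).prod * c * ((-1) ^ (l.length * (l.length - 1) / 2) * c),
      fun X => ?_⟩
    rw [conjSet, ← hl, C.prod_conj_apply, C.word_reverse hnd, hc]
    simp only [smul_mul_assoc, mul_smul_comm, smul_smul, one_mul, mul_one]
    congr 1
    ring
  have h1 : ∀ A, C.conjSet A 1 = 1 := by
    intro A
    induction A using Finset.induction_on with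
    | empty => simp
    | insert i A hi ih =>
      rw [C.conjSet_insert hi, Module.End.mul_apply, ih, conj_apply, one_mul, C.g_sq, smul_smul,
        neg_mul_neg, C.ε_sq, one_smul]
  ext1 X
  have h2 := h1 Finset.univ
  rw [hk] at h2
  rw [hk, Module.End.one_apply, ← one_mul X, ← smul_mul_assoc, h2]

theorem conjSet_compl (A : Finset (Fin 11)) : C.conjSet Aᶜ = C.conjSet A := by
  have : Aᶜ = symmDiff A Finset.univ := by
    ext i; simp [Finset.mem_symmDiff]
  rw [this, C.conjSet_symmDiff, C.conjSet_univ, mul_one]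

/-! ### The Fierz identity -/

/-- The term of the Fierz expansion of `s ⊗ s ⊗ s` with index set `A`: up to sign, it is
`⟨s, γ_A s⟩ γ_A s`. -/
def fierzTerm (s : M) (A : Finset (Fin 11)) : M :=
  C.conjSet A ((C.B s).smulRight s) s

theorem fierzTerm_singleton (s : M) (a : Fin 11) :
    C.fierzTerm s {a} = (-(C.ε a * C.B s (C.g a s))) • C.g a s := by
  simp [fierzTerm, conjSet_singleton, conj_apply, smul_smul]

theorem fierzTerm_pair (s : M) {a b : Fin 11} (h : a ≠ b) :
    C.fierzTerm s {a, b} =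
      (C.ε a * C.ε b * C.B s (C.g b (C.g a s))) • C.g a (C.g b s) := by
  rw [fierzTerm, conjSet_insert _ (by simpa using h), conjSet_singleton]
  simp [conj_apply, smul_smul]

theorem fierzTerm_compl (s : M) (A : Finset (Fin 11)) :
    C.fierzTerm s Aᶜ = C.fierzTerm s A := by
  rw [fierzTerm, C.conjSet_compl, fierzTerm]

/-- Only the ranks `1, 2` modulo `4` contribute to the Fierz expansion. -/
theorem fierzTerm_eq_zero (s : M) (A : Finset (Fin 11))
    (h : Even (A.card * (A.card + 1) / 2)) : C.fierzTerm s A = 0 := by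
  have hnd := A.nodup_toList
  have h1 := C.word_skew hnd s s
  rw [Finset.length_toList, h.neg_one_pow, one_mul, C.B_swap] at h1
  rw [fierzTerm, conjSet, C.prod_conj_apply, C.word_reverse hnd]
  simp [neg_eq_self.mp h1]

/-- The sign by which `γ_a` commutes with the Clifford word of `A`. -/
def commSign (K : Type*) [Field K] (a : Fin 11) (A : Finset (Fin 11)) : K :=
  (-1) ^ (A.card + if a ∈ A then 1 else 0)

theorem conjSet_g_mul (A : Finset (Fin 11)) (a : Fin 11) (X : Module.End K M) :
    C.conjSet A (C.g a * X) = commSign K a A • (C.g a * C.conjSet A X) := by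
  rw [conjSet, C.prod_conj_g_mul, commSign, Finset.length_toList]
  congr 4
  by_cases h : a ∈ A
  · rw [if_pos h, List.count_eq_one_of_mem A.nodup_toList (by simpa using h)]
  · rw [if_neg h, List.count_eq_zero_of_not_mem (by simpa using h)]

theorem trace_smulRight_B (s x : M) :
    LinearMap.trace K M ((C.B s).smulRight x) = C.B s x := by
  have := C.finite
  have h := LinearMap.trace_eq_contract_apply (R := K) (M := M) (C.B s ⊗ₜ x)
  rw [contractLeft_apply] at h
  rw [← h]
  rfl

theorem g_mul_smulRight (s x : M) (a : Fin 11) :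
    (C.B s).smulRight (C.g a x) = C.g a * (C.B s).smulRight x := by
  ext t; simp

/-- Fierz expansion of `γ_a s ⊗ s ⊗ s`, after `γ_a` has been moved back to the front. -/
theorem sum_commSign_fierzTerm (s : M) (a : Fin 11) :
    ∑ A, commSign K a A • C.fierzTerm s A = (64 : K) • C.fierzTerm s {a} := by
  have h := congrArg (fun X : Module.End K M => (-C.ε a) • C.g a (X s))
    (C.sum_conjSet ((C.B s).smulRight (C.g a s)))
  simp only [C.g_mul_smulRight, C.conjSet_g_mul, LinearMap.sum_apply, LinearMap.smul_apply,
    Module.End.mul_apply, map_sum, map_smul, Finset.smul_sum, Module.End.one_apply] at h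
  rw [← C.g_mul_smulRight, C.trace_smulRight_B] at h
  have hg : ∀ x, C.g a (C.g a x) = (-C.ε a) • x := fun x => by
    rw [← Module.End.mul_apply, C.g_sq]; rfl
  simp only [hg, smul_smul] at h
  rw [fierzTerm_singleton, smul_smul]
  convert h using 2
  · rename_i A _
    rw [fierzTerm]
    congr 1
    linear_combination (-commSign K a A) * C.ε_sq a
  · ring

/-- Fierz expansion of `γ_a γ_b s ⊗ s ⊗ s`, after `γ_a γ_b` has been moved back to the front. -/
theorem sum_commSign_mul_fierzTerm (s : M) {a b : Fin 11} (hab : a ≠ b) :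
    ∑ A, (commSign K a A * commSign K b A) • C.fierzTerm s A =
      (64 : K) • C.fierzTerm s {a, b} := by
  have h := congrArg (fun X : Module.End K M => (C.ε a * C.ε b) • C.g b (C.g a (X s)))
    (C.sum_conjSet ((C.B s).smulRight (C.g a (C.g b s))))
  simp only [C.g_mul_smulRight, C.conjSet_g_mul, LinearMap.sum_apply, LinearMap.smul_apply,
    Module.End.mul_apply, map_sum, map_smul, Finset.smul_sum, Module.End.one_apply,
    mul_smul_comm] at h
  rw [← C.g_mul_smulRight, ← C.g_mul_smulRight, C.trace_smulRight_B] at h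
  have hg : ∀ a x, C.g a (C.g a x) = (-C.ε a) • x := fun a x => by
    rw [← Module.End.mul_apply, C.g_sq]; rfl
  simp only [hg, map_smul, smul_smul] at h
  have hba : ∀ x, C.g b (C.g a x) = -C.g a (C.g b x) := fun x => by
    rw [← Module.End.mul_apply, C.g_anticomm hab.symm]; rfl
  rw [C.fierzTerm_pair s hab, smul_smul, hba]
  rw [hba, smul_neg, ← neg_smul] at h
  convert h using 2
  · rename_i A _
    rw [fierzTerm]
    congr 1
    linear_combination (-(commSign K a A * commSign K b A)) * (C.ε b * C.ε b * C.ε_sq a + C.ε_sq b)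
  · rw [map_neg]; ring

theorem sum_erase_commSign (b : Fin 11) (A : Finset (Fin 11)) :
    ∑ a ∈ Finset.univ.erase b, commSign K a A =
      (-1) ^ A.card * (10 - 2 * ((A.erase b).card : K)) := by
  have h1 : ∀ a, commSign K a A = (-1) ^ A.card * (1 - 2 * if a ∈ A then 1 else 0) := by
    intro a
    rw [commSign, pow_add]
    split_ifs <;> norm_num
  simp_rw [h1]
  rw [← Finset.mul_sum, Finset.sum_sub_distrib, ← Finset.mul_sum, Finset.sum_const,
    Finset.card_erase_of_mem (Finset.mem_univ _), Finset.sum_boole]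
  have : {a ∈ Finset.univ.erase b | a ∈ A} = A.erase b := by
    ext a; simp
  rw [this]
  norm_num

/-- Half of the weights with which the Fierz terms enter the difference of the two families of
Fierz identities: the other half comes from the complementary sets. -/
def fierzWeight (K : Type*) [Field K] (b : Fin 11) (A : Finset (Fin 11)) : K :=
  (if b ∉ A ∧ A.card = 1 then -16 else 0) + (if b ∈ A ∧ A.card = 2 then 16 else 0)

/-- In the sum over `a ≠ b` of the differences of the two Fierz expansions, the terms of rank five
and six have weight zero. -/
theorem weight_smul_fierzTerm (s : M) (b : Fin 11) (A : Finset (Fin 11)) :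
    ((∑ a ∈ Finset.univ.erase b, commSign K a A) * (1 - commSign K b A)) • C.fierzTerm s A =
      (fierzWeight K b A + fierzWeight K b Aᶜ) • C.fierzTerm s A := by
  by_cases hT : Even (A.card * (A.card + 1) / 2)
  · rw [C.fierzTerm_eq_zero s A hT, smul_zero, smul_zero]
  congr 1
  have hle : A.card ≤ 11 := A.card_le_univ
  rw [sum_erase_commSign, fierzWeight, fierzWeight, Finset.card_compl, Fintype.card_fin,
    commSign]
  by_cases hb : b ∈ A
  · rw [Finset.card_erase_of_mem hb]
    simp only [Finset.mem_compl, hb, not_true_eq_false, not_false_eq_true, false_and, true_and,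
      if_false]
    interval_cases A.card <;> first | (exfalso; exact hT (by decide)) | norm_num
  · rw [Finset.erase_eq_of_notMem hb]
    simp only [Finset.mem_compl, hb, not_true_eq_false, not_false_eq_true, false_and, true_and,
      if_false]
    interval_cases A.card <;> first | (exfalso; exact hT (by decide)) | norm_num

theorem sum_fierzWeight (s : M) (b : Fin 11) :
    ∑ A, fierzWeight K b A • C.fierzTerm s A =
      (-16 : K) • ∑ a ∈ Finset.univ.erase b, C.fierzTerm s {a} +
      (16 : K) • ∑ a ∈ Finset.univ.erase b, C.fierzTerm s {a, b} := by
  simp only [fierzWeight, add_smul, Finset.sum_add_distrib, ite_smul, zero_smul]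
  rw [← Finset.sum_filter, ← Finset.sum_filter, ← Finset.smul_sum, ← Finset.smul_sum]
  congr 2
  · symm
    refine Finset.sum_bij (fun a _ => {a}) ?_ ?_ ?_ ?_
    · intro a ha
      simp [Ne.symm (Finset.ne_of_mem_erase ha)]
    · intro a _ a' _ h
      simpa using h
    · intro A hA
      obtain ⟨-, hbA, hc⟩ := Finset.mem_filter.mp hA
      obtain ⟨a, rfl⟩ := Finset.card_eq_one.mp hc
      exact ⟨a, by simpa using fun h => hbA (by simp [h]), rfl⟩
    · intros; rfl
  · symm
    refine Finset.sum_bij (fun a _ => {a, b}) ?_ ?_ ?_ ?_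
    · intro a ha
      simp [Finset.card_pair (Finset.ne_of_mem_erase ha)]
    · intro a ha a' _ h
      have : a ∈ ({a', b} : Finset (Fin 11)) := by rw [← h]; simp
      simpa [Finset.ne_of_mem_erase ha] using this
    · intro A hA
      obtain ⟨-, hbA, hc⟩ := Finset.mem_filter.mp hA
      have h1 : (A.erase b).card = 1 := by rw [Finset.card_erase_of_mem hbA, hc]
      obtain ⟨a, ha⟩ := Finset.card_eq_one.mp h1
      have hab : a ≠ b := Finset.ne_of_mem_erase (by rw [ha]; simp : a ∈ A.erase b)
      refine ⟨a, by simpa using hab, ?_⟩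
      rw [← Finset.insert_erase hbA, ha, Finset.pair_comm]
    · intros; rfl

/-- The rank-one and rank-two parts of the Fierz expansion through a fixed index agree. -/
theorem sum_fierzTerm_singleton_eq (s : M) (b : Fin 11) :
    ∑ a ∈ Finset.univ.erase b, C.fierzTerm s {a} =
      ∑ a ∈ Finset.univ.erase b, C.fierzTerm s {a, b} := by
  have h1 : ∑ A, ((∑ a ∈ Finset.univ.erase b, commSign K a A) * (1 - commSign K b A)) •
      C.fierzTerm s A = (64 : K) • ∑ a ∈ Finset.univ.erase b, C.fierzTerm s {a} -
        (64 : K) • ∑ a ∈ Finset.univ.erase b, C.fierzTerm s {a, b} := by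
    rw [Finset.smul_sum, Finset.smul_sum]
    rw [← Finset.sum_congr rfl fun a _ => C.sum_commSign_fierzTerm s a,
      ← Finset.sum_congr rfl fun a ha =>
        C.sum_commSign_mul_fierzTerm s (Finset.ne_of_mem_erase ha)]
    rw [Finset.sum_comm, Finset.sum_comm (s := Finset.univ.erase b), ← Finset.sum_sub_distrib]
    refine Finset.sum_congr rfl fun A _ => ?_
    rw [← Finset.sum_smul, ← Finset.sum_smul, ← sub_smul, ← Finset.sum_mul, mul_sub, mul_one]
  have h2 : ∑ A, fierzWeight K b Aᶜ • C.fierzTerm s A = ∑ A, fierzWeight K b A • C.fierzTerm s A := by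
    rw [← Equiv.sum_comp (compl_involutive (α := Finset (Fin 11))).toPerm
      (fun A => fierzWeight K b A • C.fierzTerm s A)]
    refine Finset.sum_congr rfl fun A _ => ?_
    rw [Function.Involutive.coe_toPerm, C.fierzTerm_compl]
  simp only [C.weight_smul_fierzTerm, add_smul] at h1
  rw [Finset.sum_add_distrib, h2, C.sum_fierzWeight] at h1
  set x := ∑ a ∈ Finset.univ.erase b, C.fierzTerm s {a}
  set y := ∑ a ∈ Finset.univ.erase b, C.fierzTerm s {a, b}
  have h3 : (96 : K) • (x - y) = 0 := by
    rw [← sub_eq_zero] at h1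
    rw [← neg_eq_zero, ← h1]
    module
  exact sub_eq_zero.mp ((smul_eq_zero.mp h3).resolve_left (by norm_num))

/-- The case of `fierz_two_form` in which `v` is a basis vector. -/
theorem fierz_basis (s : M) (k : E) (hk : ∀ v, C.η k v = C.B s (C.γ v s)) (j : Fin 11) :
    ∑ a, (C.ε a * C.B s (C.g j (C.g a s))) • C.g a s =
      C.γ k (C.g j s) + C.η k (C.b j) • s := by
  have hg : ∀ a x, C.g a (C.g a x) = (-C.ε a) • x := fun a x => by
    rw [← Module.End.mul_apply, C.g_sq]; rfl
  have h := congrArg (C.g j) (C.sum_fierzTerm_singleton_eq s j)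
  rw [map_sum, map_sum] at h
  have hL : ∑ a ∈ Finset.univ.erase j, C.g j (C.fierzTerm s {a, j}) =
      ∑ a, (C.ε a * C.B s (C.g j (C.g a s))) • C.g a s := by
    rw [← Finset.add_sum_erase _ _ (Finset.mem_univ j), hg, map_smul, C.B_self, smul_zero,
      mul_zero, zero_smul, zero_add]
    refine Finset.sum_congr rfl fun a ha => ?_
    have haj := Finset.ne_of_mem_erase ha
    have : C.g a (C.g j s) = -C.g j (C.g a s) := by
      rw [← Module.End.mul_apply, C.g_anticomm haj]; rfl
    rw [C.fierzTerm_pair s haj, this, smul_neg, map_neg, map_smul, hg, smul_smul, ← neg_smul]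
    congr 1
    linear_combination (C.ε a * C.B s (C.g j (C.g a s))) * C.ε_sq j
  have hγk : C.γ k s = ∑ a, (C.ε a * C.B s (C.g a s)) • C.g a s := by
    conv_lhs => rw [← C.sum_basis k]
    simp only [map_sum, map_smul, LinearMap.sum_apply, LinearMap.smul_apply, hk]
    rfl
  have hR : ∑ a ∈ Finset.univ.erase j, C.g j (C.fierzTerm s {a}) =
      -C.g j (C.γ k s) - C.η k (C.b j) • s := by
    rw [hγk, map_sum, ← Finset.add_sum_erase _ _ (Finset.mem_univ j), map_smul, hg, smul_smul,
      hk]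
    have h0 : (C.ε j * C.B s (C.g j s) * -C.ε j) • s = -(C.B s (C.γ (C.b j) s) • s) := by
      rw [← neg_smul]
      congr 1
      change _ = -(C.B s (C.g j s))
      linear_combination (-C.B s (C.g j s)) * C.ε_sq j
    rw [h0]
    simp only [C.fierzTerm_singleton, map_smul, neg_smul, Finset.sum_neg_distrib, map_neg]
    abel
  rw [← hL, ← h, hR]
  have := C.clifford_apply k (C.b j) s
  rw [g, this, two_mul, add_smul]
  abel

/-- The cubic Fierz identity behind the supermembrane: if `k` is the Dirac current of `s` and `u`
is the contraction of `v` with the two-form of `s`, then `u · s = (k ∧ v) · s`. -/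
theorem fierz_two_form (s : M) (k : E) (hk : ∀ v, C.η k v = C.B s (C.γ v s)) (u v : E)
    (hu : ∀ w, C.η u w = C.B s (C.γ v (C.γ w s))) :
    C.γ u s = C.γ k (C.γ v s) + C.η k v • s := by
  have h1 : C.γ u s = ∑ a, (C.ε a * C.B s (C.γ v (C.g a s))) • C.g a s := by
    conv_lhs => rw [← C.sum_basis u]
    simp only [map_sum, map_smul, LinearMap.sum_apply, LinearMap.smul_apply, hu]
    rfl
  let L : E →ₗ[K] M := ∑ a, (C.ε a • (C.B s ∘ₗ C.γ.flip (C.g a s))).smulRight (C.g a s)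
  let R : E →ₗ[K] M := C.γ k ∘ₗ C.γ.flip s + (C.η k).smulRight s
  have hLR : L = R := C.b.ext fun j => by
    have := C.fierz_basis s k hk j
    simpa [L, R, g] using this
  have h2 := LinearMap.congr_fun hLR v
  rw [h1]
  simpa [L, R] using h2

end CliffordSpinors

/-! ### Antisymmetrised Clifford products -/

/-- An adjacent transposition changes the sign of a product of anticommuting elements. -/
theorem prod_ofFn_comp_swap {R : Type*} [Ring R] (n : ℕ) (x : Fin (n + 1) → R)
    (hx : ∀ i j, i ≠ j → x i * x j = -(x j * x i)) (k : Fin n) :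
    (List.ofFn (x ∘ Equiv.swap k.castSucc k.succ)).prod = -(List.ofFn x).prod := by
  induction n with
  | zero => exact k.elim0
  | succ n ih =>
    cases k using Fin.cases with
    | zero =>
      have h0 : ∀ i : Fin n, Equiv.swap (0 : Fin (n + 2)) 1 i.succ.succ = i.succ.succ := fun i =>
        Equiv.swap_apply_of_ne_of_ne (Fin.succ_ne_zero _)
          (fun h => Fin.succ_ne_zero i (Fin.succ_injective _ h))
      simp only [List.ofFn_succ, Function.comp_apply, List.prod_cons, Fin.castSucc_zero,
        Fin.succ_zero_eq_one, Equiv.swap_apply_left, Equiv.swap_apply_right, h0]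
      rw [← mul_assoc, hx 1 0 (by simp), neg_mul, mul_assoc]
    | succ k =>
      have h0 : Equiv.swap k.succ.castSucc k.succ.succ 0 = 0 :=
        Equiv.swap_apply_of_ne_of_ne (by simp [Fin.ext_iff]) (Fin.succ_ne_zero _).symm
      have h1 : ∀ i : Fin (n + 1), Equiv.swap k.succ.castSucc k.succ.succ i.succ =
          (Equiv.swap k.castSucc k.succ i).succ := fun i => by
        rw [← Fin.succ_castSucc, ← (Fin.succ_injective _).swap_apply]
      rw [List.ofFn_succ, List.prod_cons, Function.comp_apply, h0]
      have h2 := ih (fun i => x i.succ) (fun i j hij => hx _ _ (by simpa using hij)) k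
      simp only [Function.comp_def, h1] at h2 ⊢
      conv_rhs => rw [List.ofFn_succ, List.prod_cons]
      rw [h2, mul_neg]

theorem prod_ofFn_comp_perm {R : Type*} [Ring R] {n : ℕ} (x : Fin n → R)
    (hx : ∀ i j, i ≠ j → x i * x j = -(x j * x i)) (σ : Equiv.Perm (Fin n)) :
    (List.ofFn (x ∘ σ)).prod = Equiv.Perm.sign σ • (List.ofFn x).prod := by
  cases n with
  | zero => simp [Subsingleton.elim σ 1]
  | succ n =>
    have hσ : σ ∈ Submonoid.closure (Set.range fun i : Fin n => Equiv.swap i.castSucc i.succ) := by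
      rw [Equiv.Perm.mclosure_swap_castSucc_succ]; trivial
    induction hσ using Submonoid.closure_induction generalizing x with
    | mem τ hτ =>
      obtain ⟨k, rfl⟩ := hτ
      rw [prod_ofFn_comp_swap n x hx k, Equiv.Perm.sign_swap (Fin.castSucc_lt_succ).ne]
      simp
    | one => simp
    | mul τ τ' _ _ h h' =>
      have : x ∘ ⇑(τ * τ') = (x ∘ τ) ∘ τ' := rfl
      rw [this, h' (x ∘ τ) (fun i j hij => hx _ _ (fun h => hij (τ.injective h))), h x hx,
        smul_smul, map_mul, mul_comm]

theorem wedgeAction_apply {K E M : Type*} [Field K] [AddCommGroup E] [Module K E]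
    [AddCommGroup M] [Module K M] (γ : E →ₗ[K] Module.End K M) (q : ℕ) (v : Fin q → E) :
    wedgeAction γ q v = ((q.factorial : K)⁻¹) •
      ∑ σ : Equiv.Perm (Fin q), Equiv.Perm.sign σ • (List.ofFn fun i => γ (v (σ i))).prod := by
  rw [wedgeAction, AlternatingMap.smul_apply, MultilinearMap.alternatization_apply]
  congr 1

namespace CliffordSpinors

set_option linter.unusedSectionVars false

variable {K E M : Type*} [Field K] [CharZero K] [AddCommGroup E] [Module K E]
  [AddCommGroup M] [Module K M] (C : CliffordSpinors K E M)

theorem word_ofFn {q : ℕ} (f : Fin q → Fin 11) :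
    C.word (List.ofFn f) = (List.ofFn fun i => C.g (f i)).prod := by
  rw [word, List.map_ofFn]; rfl

theorem word_ofFn_comp_perm {q : ℕ} {f : Fin q → Fin 11} (hf : Function.Injective f)
    (σ : Equiv.Perm (Fin q)) :
    C.word (List.ofFn (f ∘ σ)) = Equiv.Perm.sign σ • C.word (List.ofFn f) := by
  rw [word_ofFn, word_ofFn]
  exact prod_ofFn_comp_perm (fun i => C.g (f i))
    (fun i j hij => C.g_anticomm (fun h => hij (hf h))) σ

theorem wedgeAction_basis {q : ℕ} {f : Fin q → Fin 11} (hf : Function.Injective f) :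
    wedgeAction C.γ q (fun i => C.b (f i)) = C.word (List.ofFn f) := by
  rw [wedgeAction_apply]
  have h : ∀ σ : Equiv.Perm (Fin q),
      Equiv.Perm.sign σ • (List.ofFn fun i => C.γ (C.b (f (σ i)))).prod =
        C.word (List.ofFn f) := by
    intro σ
    have := C.word_ofFn_comp_perm hf σ
    rw [word_ofFn] at this
    change Equiv.Perm.sign σ • (List.ofFn fun i => C.g ((f ∘ σ) i)).prod = _
    rw [this, smul_smul, Int.units_mul_self, one_smul]
  simp_rw [h]
  rw [Finset.sum_const, Finset.card_univ, Fintype.card_perm, Fintype.card_fin,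
    ← Nat.cast_smul_eq_nsmul K, smul_smul,
    inv_mul_cancel₀ (Nat.cast_ne_zero.mpr q.factorial_ne_zero), one_smul]

/-- In ranks `1, 2` modulo `4`, the bilinear form `⟨x, (v₁ ∧ ⋯ ∧ v_q) · y⟩` is symmetric. -/
theorem B_wedgeAction_symm {q : ℕ} (hq : Odd (q * (q + 1) / 2)) (v : Fin q → E) (x y : M) :
    C.B x (wedgeAction C.γ q v y) = C.B y (wedgeAction C.γ q v x) := by
  have h : (C.B x ∘ₗ LinearMap.applyₗ y).compAlternatingMap (wedgeAction C.γ q) =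
      (C.B y ∘ₗ LinearMap.applyₗ x).compAlternatingMap (wedgeAction C.γ q) := by
    refine Module.Basis.ext_alternating C.b fun f hf => ?_
    simp only [LinearMap.compAlternatingMap_apply, LinearMap.comp_apply,
      LinearMap.applyₗ_apply_apply, C.wedgeAction_basis hf]
    have := C.word_skew (List.nodup_ofFn.mpr hf) y x
    rw [List.length_ofFn, hq.neg_one_pow, C.B_swap] at this
    linear_combination -this
  exact congrArg (fun F => F v) h

/-! ### The Clifford endomorphism of a form -/

/-- The Clifford endomorphism of a form `θ`, normalised so that the trace pairing with the
antisymmetrised Clifford products gives back `θ` in degrees `1`, `2` and `5`. -/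
def endOfForm (q : ℕ) (θ : E [⋀^Fin q]→ₗ[K] K) : Module.End K M :=
  (-(32 * (q.factorial : K)))⁻¹ • ∑ f : Fin q → Fin 11,
    ((∏ i, C.ε (f i)) * θ fun i => C.b (f i)) • C.word (List.ofFn f)

theorem form_basis_eq_zero {q : ℕ} (θ : E [⋀^Fin q]→ₗ[K] K) {f : Fin q → Fin 11}
    (hf : ¬ Function.Injective f) : θ (fun i => C.b (f i)) = 0 := by
  rw [Function.Injective] at hf
  push Not at hf
  obtain ⟨i, j, hij, hne⟩ := hf
  exact θ.map_eq_zero_of_eq _ (by simp [hij]) hne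

theorem endOfForm_skew {q : ℕ} (hq : Odd (q * (q + 1) / 2)) (θ : E [⋀^Fin q]→ₗ[K] K) (x y : M) :
    C.B (C.endOfForm q θ x) y = -C.B x (C.endOfForm q θ y) := by
  simp only [endOfForm, LinearMap.smul_apply, LinearMap.sum_apply, map_smul, map_sum]
  rw [← smul_neg, ← Finset.sum_neg_distrib]
  congr 1
  refine Finset.sum_congr rfl fun f _ => ?_
  by_cases hf : Function.Injective f
  · rw [C.word_skew (List.nodup_ofFn.mpr hf), List.length_ofFn, hq.neg_one_pow]
    simp
  · simp [C.form_basis_eq_zero θ hf]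

theorem exists_notMem_ofFn {q q' : ℕ} (h : q + q' < 11) (f : Fin q → Fin 11)
    (f' : Fin q' → Fin 11) : ∃ k, k ∉ List.ofFn f ∧ k ∉ List.ofFn f' := by
  by_contra! hcon
  have h1 : (Finset.univ : Finset (Fin 11)) ⊆
      (List.ofFn f).toFinset ∪ (List.ofFn f').toFinset := by
    intro k _
    rw [Finset.mem_union, List.mem_toFinset, List.mem_toFinset]
    by_cases hk : k ∈ List.ofFn f
    · exact Or.inl hk
    · exact Or.inr (hcon k hk)
  have h2 := (Finset.card_le_card h1).trans (Finset.card_union_le _ _)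
  have h3 := List.toFinset_card_le (List.ofFn f)
  have h4 := List.toFinset_card_le (List.ofFn f')
  rw [List.length_ofFn] at h3 h4
  rw [Finset.card_univ, Fintype.card_fin] at h2
  omega

theorem trace_wedgeAction_endOfForm_of_ne {q q' : ℕ} (hne : q ≠ q') (h : q + q' < 11)
    (θ : E [⋀^Fin q]→ₗ[K] K) (v : Fin q' → E) :
    LinearMap.trace K M (wedgeAction C.γ q' v * C.endOfForm q θ) = 0 := by
  have h : (LinearMap.trace K M ∘ₗ LinearMap.mulRight K (C.endOfForm q θ)).compAlternatingMap
      (wedgeAction C.γ q') = 0 := by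
    refine Module.Basis.ext_alternating C.b fun g hg => ?_
    simp only [LinearMap.compAlternatingMap_apply, LinearMap.comp_apply,
      C.wedgeAction_basis hg, LinearMap.mulRight_apply, AlternatingMap.zero_apply]
    simp only [endOfForm, mul_smul_comm, Finset.mul_sum, map_smul, map_sum]
    rw [Finset.sum_eq_zero, smul_zero]
    intro f _
    by_cases hf : Function.Injective f
    · obtain ⟨k, hk, hk'⟩ := exists_notMem_ofFn h f g
      rw [C.trace_word_mul_word_eq_zero (List.nodup_ofFn.mpr hg) (List.nodup_ofFn.mpr hf) _ hk' hk,
        smul_zero]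
      intro heq
      have := congrArg Finset.card heq
      rw [List.toFinset_card_of_nodup (List.nodup_ofFn.mpr hg),
        List.toFinset_card_of_nodup (List.nodup_ofFn.mpr hf), List.length_ofFn,
        List.length_ofFn] at this
      exact hne this.symm
    · simp [C.form_basis_eq_zero θ hf]
  exact congrArg (fun F => F v) h

theorem trace_wedgeAction_endOfForm {q : ℕ} (hq : Odd (q * (q + 1) / 2)) (h : q + q < 11)
    (θ : E [⋀^Fin q]→ₗ[K] K) (v : Fin q → E) :
    LinearMap.trace K M (wedgeAction C.γ q v * C.endOfForm q θ) = θ v := by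
  have h : (LinearMap.trace K M ∘ₗ LinearMap.mulRight K (C.endOfForm q θ)).compAlternatingMap
      (wedgeAction C.γ q) = θ := by
    refine Module.Basis.ext_alternating C.b fun g hg => ?_
    simp only [LinearMap.compAlternatingMap_apply, LinearMap.comp_apply,
      C.wedgeAction_basis hg, LinearMap.mulRight_apply]
    simp only [endOfForm, mul_smul_comm, Finset.mul_sum, map_smul, map_sum]
    have hnd := List.nodup_ofFn.mpr hg
    -- only the rearrangements of `g` contribute to the trace
    have hsum : ∑ f : Fin q → Fin 11, ((∏ i, C.ε (f i)) * θ fun i => C.b (f i)) •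
          LinearMap.trace K M (C.word (List.ofFn g) * C.word (List.ofFn f)) =
        ∑ σ : Equiv.Perm (Fin q), ((∏ i, C.ε (g (σ i))) * θ fun i => C.b (g (σ i))) •
          LinearMap.trace K M (C.word (List.ofFn g) * C.word (List.ofFn (g ∘ σ))) := by
      symm
      refine Finset.sum_of_injOn (fun σ => g ∘ σ) ?_ (by simp) ?_ (fun σ _ => rfl)
      · intro σ _ τ _ hστ
        ext i
        have := congrFun hστ i
        exact congrArg Fin.val (hg this)
      · intro f _ hf
        by_cases hfi : Function.Injective f
        · obtain ⟨k, hk, hk'⟩ := exists_notMem_ofFn h f g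
          rw [C.trace_word_mul_word_eq_zero hnd (List.nodup_ofFn.mpr hfi) _ hk' hk, smul_zero]
          intro heq
          refine hf ?_
          have hmem : ∀ i, ∃ j, g j = f i := fun i => by
            have : f i ∈ (List.ofFn g).toFinset := by
              rw [heq, List.mem_toFinset, List.mem_ofFn]; exact ⟨i, rfl⟩
            rwa [List.mem_toFinset, List.mem_ofFn] at this
          choose σ hσ using hmem
          have hσi : Function.Injective σ := fun i j hij => hfi (by rw [← hσ, ← hσ, hij])
          refine ⟨Equiv.ofBijective σ (Finite.injective_iff_bijective.mp hσi), by simp, ?_⟩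
          ext1 i
          exact hσ i
        · simp [C.form_basis_eq_zero θ hfi]
    rw [hsum]
    have hself : LinearMap.trace K M (C.word (List.ofFn g) * C.word (List.ofFn g)) =
        -(32 * ∏ i, C.ε (g i)) := by
      have h1 := C.word_mul_word_reverse (List.ofFn g)
      rw [C.word_reverse hnd, List.length_ofFn, mul_smul_comm] at h1
      have h2 := congrArg (fun X => (-1 : K) ^ (q * (q - 1) / 2) • X) h1
      simp only [smul_smul] at h2
      rw [← pow_add, Even.neg_one_pow ⟨_, rfl⟩, one_smul] at h2
      rw [h2, map_smul, C.trace_one, List.map_ofFn, List.prod_ofFn, smul_eq_mul]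
      simp only [Function.comp_apply]
      rw [Finset.prod_neg, Finset.card_univ, Fintype.card_fin, ← mul_assoc, ← pow_add]
      have h3 : q * (q - 1) / 2 + q = q * (q + 1) / 2 := by
        rw [← Finset.sum_range_id, ← Finset.sum_range_succ, Finset.sum_range_id]
        rw [Nat.add_sub_cancel, mul_comm]
      rw [h3, hq.neg_one_pow]
      ring
    have hterm : ∀ σ : Equiv.Perm (Fin q),
        ((∏ i, C.ε (g (σ i))) * θ fun i => C.b (g (σ i))) •
          LinearMap.trace K M (C.word (List.ofFn g) * C.word (List.ofFn (g ∘ σ))) =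
        -32 * θ fun i => C.b (g i) := by
      intro σ
      have h1 := θ.map_perm (fun i => C.b (g i)) σ
      have h1' : (θ fun i => C.b (g (σ i))) = Equiv.Perm.sign σ • θ fun i => C.b (g i) := h1
      have h2 : ∏ i, C.ε (g (σ i)) = ∏ i, C.ε (g i) :=
        Equiv.prod_comp σ fun i => C.ε (g i)
      have h3 : (∏ i, C.ε (g i)) * ∏ i, C.ε (g i) = 1 := by
        rw [← Finset.prod_mul_distrib]
        exact Finset.prod_eq_one fun i _ => C.ε_sq _
      rw [C.word_ofFn_comp_perm hg, h1', h2]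
      rcases Int.units_eq_one_or (Equiv.Perm.sign σ) with hs | hs
      · rw [hs, one_smul, one_smul, hself, smul_eq_mul]
        linear_combination (-32 * θ fun i => C.b (g i)) * h3
      · rw [hs]
        simp only [Units.neg_smul, one_smul, mul_neg, map_neg, hself, smul_eq_mul]
        linear_combination (-32 * θ fun i => C.b (g i)) * h3
    simp_rw [hterm]
    rw [Finset.sum_const, Finset.card_univ, Fintype.card_perm, Fintype.card_fin, nsmul_eq_mul,
      smul_eq_mul]
    have : (q.factorial : K) ≠ 0 := Nat.cast_ne_zero.mpr q.factorial_ne_zero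
    field_simp
  exact congrArg (fun F => F v) h

/-! ### Bispinors with prescribed pairings -/

theorem add_comm_mem_span_diag (ω : M ⊗[K] M) :
    ω + TensorProduct.comm K M M ω ∈ Submodule.span K {ω | ∃ t : M, ω = t ⊗ₜ[K] t} := by
  induction ω using TensorProduct.induction_on with
  | zero => simp
  | tmul x y =>
    have h : x ⊗ₜ[K] y + TensorProduct.comm K M M (x ⊗ₜ[K] y) =
        (x + y) ⊗ₜ[K] (x + y) - x ⊗ₜ[K] x - y ⊗ₜ[K] y := by
      rw [TensorProduct.comm_tmul, TensorProduct.tmul_add, TensorProduct.add_tmul,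
        TensorProduct.add_tmul]
      abel
    rw [h]
    exact sub_mem (sub_mem (Submodule.subset_span ⟨_, rfl⟩) (Submodule.subset_span ⟨_, rfl⟩))
      (Submodule.subset_span ⟨_, rfl⟩)
  | add a b ha hb =>
    rw [map_add, add_add_add_comm]
    exact add_mem ha hb

/-- A tensor fixed by the flip is a combination of squares. -/
theorem mem_span_diag_of_comm_eq {ω : M ⊗[K] M} (h : TensorProduct.comm K M M ω = ω) :
    ω ∈ Submodule.span K {ω | ∃ t : M, ω = t ⊗ₜ[K] t} := by
  have h1 := add_comm_mem_span_diag ω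
  rw [h, ← two_smul K] at h1
  have h2 := Submodule.smul_mem _ (2 : K)⁻¹ h1
  rwa [smul_smul, inv_mul_cancel₀ two_ne_zero, one_smul] at h2

/-- The isomorphism `M ⊗ M ≃ End M` given by the symplectic form: `x ⊗ y` acts as
`t ↦ ⟨x, t⟩ y`. -/
def bispinorEquiv : M ⊗[K] M ≃ₗ[K] Module.End K M :=
  haveI := C.finite
  (TensorProduct.congr (C.B.toDual C.B_nondegenerate) (LinearEquiv.refl K M)).trans
    (dualTensorHomEquiv K M M)

theorem bispinorEquiv_tmul (x y t : M) : C.bispinorEquiv (x ⊗ₜ y) t = C.B x t • y := by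
  have := C.finite
  simp [bispinorEquiv, LinearMap.BilinForm.toDual_def]

theorem bispinorEquiv_comm (ω : M ⊗[K] M) (t r : M) :
    C.B (C.bispinorEquiv (TensorProduct.comm K M M ω) t) r =
      C.B (C.bispinorEquiv ω r) t := by
  induction ω using TensorProduct.induction_on with
  | zero => simp
  | tmul x y => simp [bispinorEquiv_tmul, mul_comm]
  | add a b ha hb => simp only [map_add, LinearMap.add_apply, ha, hb]

theorem comm_bispinorEquiv_symm {X : Module.End K M}
    (hX : ∀ x y, C.B (X x) y = -C.B x (X y)) :
    TensorProduct.comm K M M (C.bispinorEquiv.symm X) = C.bispinorEquiv.symm X := by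
  apply C.bispinorEquiv.injective
  ext1 t
  rw [← sub_eq_zero]
  refine C.B_nondegenerate.1 _ fun r => ?_
  rw [map_sub, LinearMap.sub_apply, C.bispinorEquiv_comm, LinearEquiv.apply_symm_apply, hX,
    C.B_swap (X t) r, sub_self]

/-- The pairing of a bispinor with `A` after applying `t ↦ t - c ⟨s, t⟩ y` to both factors. -/
theorem lift_lTensor_map (s y : M) (c : K) (A : Module.End K M)
    (hA : ∀ x x', C.B x (A x') = C.B x' (A x)) (ω : M ⊗[K] M) :
    TensorProduct.lift C.B (LinearMap.lTensor M A (TensorProduct.map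
      (LinearMap.id - (c • C.B s).smulRight y) (LinearMap.id - (c • C.B s).smulRight y) ω)) =
      LinearMap.trace K M (A * C.bispinorEquiv ω) + c * C.B y (A (C.bispinorEquiv ω s)) +
      c * C.B y (A (C.bispinorEquiv (TensorProduct.comm K M M ω) s)) -
      c * c * (C.B s (C.bispinorEquiv ω s) * C.B y (A y)) := by
  induction ω using TensorProduct.induction_on with
  | zero => simp
  | tmul x x' =>
    have htr : LinearMap.trace K M (A * C.bispinorEquiv (x ⊗ₜ x')) = C.B x (A x') := by
      have h : A * C.bispinorEquiv (x ⊗ₜ x') = (C.B x).smulRight (A x') := by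
        ext t; simp [bispinorEquiv_tmul]
      rw [h]
      have := C.finite
      have h := LinearMap.trace_eq_contract_apply (R := K) (M := M) (C.B x ⊗ₜ A x')
      rw [contractLeft_apply] at h
      rw [← h]
      rfl
    rw [htr]
    simp only [TensorProduct.map_tmul, LinearMap.lTensor_tmul, TensorProduct.lift.tmul,
      TensorProduct.comm_tmul, bispinorEquiv_tmul, LinearMap.sub_apply, LinearMap.id_apply,
      LinearMap.smulRight_apply, LinearMap.smul_apply, map_sub, map_smul, smul_eq_mul]
    rw [C.B_swap x s, C.B_swap x' s, hA x y]
    ring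
  | add a b ha hb =>
    simp only [map_add, LinearMap.add_apply, mul_add, add_mul, ha, hb]
    ring

/-- A skew endomorphism `X` yields a bispinor; projecting it along `y` into the orthogonal of `s`
changes its pairing with `A` by the pairing of `y ⊙ X s`. -/
theorem exists_bispinor {X : Module.End K M} (hX : ∀ x y, C.B (X x) y = -C.B x (X y)) {s y : M}
    (hsy : C.B s y ≠ 0) (hs : C.B s (X s) = 0) :
    ∃ ω ∈ Submodule.span K {ω | ∃ t : M, C.B s t = 0 ∧ ω = t ⊗ₜ[K] t},
      ∀ A : Module.End K M, (∀ x x', C.B x (A x') = C.B x' (A x)) →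
        TensorProduct.lift C.B (LinearMap.lTensor M A ω) =
          LinearMap.trace K M (A * X) + 2 * (C.B s y)⁻¹ * C.B y (A (X s)) := by
  set c := (C.B s y)⁻¹ with hc
  set T : Module.End K M := LinearMap.id - (c • C.B s).smulRight y with hT
  have hcomm := C.comm_bispinorEquiv_symm hX
  refine ⟨TensorProduct.map T T (C.bispinorEquiv.symm X), ?_, fun A hA => ?_⟩
  · have hmem := mem_span_diag_of_comm_eq hcomm
    have h := Submodule.mem_map_of_mem (f := TensorProduct.map T T) hmem
    rw [Submodule.map_span] at h
    refine Submodule.span_mono ?_ h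
    rintro _ ⟨_, ⟨t, rfl⟩, rfl⟩
    refine ⟨T t, ?_, TensorProduct.map_tmul _ _ _ _⟩
    simp only [hT, LinearMap.sub_apply, LinearMap.id_apply, LinearMap.smulRight_apply,
      LinearMap.smul_apply, map_sub, map_smul, smul_eq_mul]
    rw [hc]
    field_simp
    ring
  · rw [C.lift_lTensor_map s y c A hA, hcomm, LinearEquiv.apply_symm_apply, hs]
    ring

/-! ### Clifford endomorphisms of forms of given type -/

/-- Linear maps applied to the arguments of a form can be moved to the Clifford product. -/
theorem sum_form_adjoint {q : ℕ} {N : Type*} [AddCommGroup N] [Module K N]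
    (θ : MultilinearMap K (fun _ : Fin q => E) K) (G : MultilinearMap K (fun _ : Fin q => E) N)
    {P Q : Fin q → Module.End K E} (hPQ : ∀ i v w, C.η (P i v) w = C.η v (Q i w)) :
    ∑ f : Fin q → Fin 11, ((∏ i, C.ε (f i)) * θ fun i => P i (C.b (f i))) •
        G (fun i => C.b (f i)) =
      ∑ f : Fin q → Fin 11, ((∏ i, C.ε (f i)) * θ fun i => C.b (f i)) •
        G (fun i => Q i (C.b (f i))) := by
  have hP : ∀ f : Fin q → Fin 11, (θ fun i => P i (C.b (f i))) =
      ∑ h : Fin q → Fin 11, ((∏ i, C.ε (h i)) * ∏ i, C.η (P i (C.b (f i))) (C.b (h i))) *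
        θ fun i => C.b (h i) := by
    intro f
    have h1 : (fun i => P i (C.b (f i))) =
        fun i => ∑ l, (C.ε l * C.η (P i (C.b (f i))) (C.b l)) • C.b l :=
      funext fun i => (C.sum_basis _).symm
    rw [h1, MultilinearMap.map_sum]
    refine Finset.sum_congr rfl fun h _ => ?_
    rw [MultilinearMap.map_smul_univ, smul_eq_mul, Finset.prod_mul_distrib]
  have hQ : ∀ f : Fin q → Fin 11, (G fun i => Q i (C.b (f i))) =
      ∑ h : Fin q → Fin 11, ((∏ i, C.ε (h i)) * ∏ i, C.η (Q i (C.b (f i))) (C.b (h i))) •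
        G fun i => C.b (h i) := by
    intro f
    have h1 : (fun i => Q i (C.b (f i))) =
        fun i => ∑ l, (C.ε l * C.η (Q i (C.b (f i))) (C.b l)) • C.b l :=
      funext fun i => (C.sum_basis _).symm
    rw [h1, MultilinearMap.map_sum]
    refine Finset.sum_congr rfl fun h _ => ?_
    rw [MultilinearMap.map_smul_univ, Finset.prod_mul_distrib]
  simp_rw [hP, hQ, Finset.mul_sum, Finset.sum_smul, Finset.smul_sum]
  rw [Finset.sum_comm]
  refine Finset.sum_congr rfl fun f _ => Finset.sum_congr rfl fun h _ => ?_
  rw [smul_smul]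
  congr 1
  have : ∏ i, C.η (P i (C.b (h i))) (C.b (f i)) = ∏ i, C.η (Q i (C.b (f i))) (C.b (h i)) :=
    Finset.prod_congr rfl fun i _ => by rw [hPQ, C.η_symm]
  rw [this]
  ring

/-- A pair of opposite pure spinors `z`, `z'` in a Clifford module: `ℓ` is a unit
vector of which they are eigenvectors, `U` and `U'` are spaces of vectors orthogonal to `ℓ`
which annihilate `z` and `z'`, and `P`, `P'` are the projections onto them. That `U` and `U'` are
isotropic is not needed. -/
structure Polarization where
  /-- the unit vector -/
  ℓ : E
  /-- the vectors annihilating `z` -/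
  U : Submodule K E
  /-- the vectors annihilating `z'` -/
  U' : Submodule K E
  /-- the projection onto `U` -/
  P : Module.End K E
  /-- the projection onto `U'` -/
  P' : Module.End K E
  /-- the eigenvalue of `ℓ` on `z` -/
  ι : K
  /-- the first pure spinor -/
  z : M
  /-- the second pure spinor -/
  z' : M
  η_ℓ : C.η ℓ ℓ = 1
  sum_eq : ∀ v, C.η ℓ v • ℓ + P v + P' v = v
  P_mem : ∀ v, P v ∈ U
  P'_mem : ∀ v, P' v ∈ U'
  adjoint : ∀ v w, C.η (P v) w = C.η v (P' w)
  U_perp : ∀ u ∈ U, C.η ℓ u = 0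
  U'_perp : ∀ u ∈ U', C.η ℓ u = 0
  ι_ne_zero : ι ≠ 0
  ℓ_z : C.γ ℓ z = ι • z
  ℓ_z' : C.γ ℓ z' = -ι • z'
  U_z : ∀ u ∈ U, C.γ u z = 0
  U'_z' : ∀ u ∈ U', C.γ u z' = 0
  pure : ∀ n, C.η ℓ n = 0 → C.B z (C.γ n z) = 0
  pure' : ∀ n, C.η ℓ n = 0 → C.B z' (C.γ n z') = 0
  B_ne_zero : C.B z z' ≠ 0

namespace Polarization

variable {C} (p : C.Polarization)

/-- The polarization with the two pure spinors exchanged. -/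
def symm : C.Polarization where
  ℓ := p.ℓ
  U := p.U'
  U' := p.U
  P := p.P'
  P' := p.P
  ι := -p.ι
  z := p.z'
  z' := p.z
  η_ℓ := p.η_ℓ
  sum_eq v := by rw [add_right_comm]; exact p.sum_eq v
  P_mem := p.P'_mem
  P'_mem := p.P_mem
  adjoint v w := by rw [C.η_symm, ← p.adjoint, C.η_symm]
  U_perp := p.U'_perp
  U'_perp := p.U_perp
  ι_ne_zero := neg_ne_zero.mpr p.ι_ne_zero
  ℓ_z := p.ℓ_z'
  ℓ_z' := by rw [neg_neg]; exact p.ℓ_z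
  U_z := p.U'_z'
  U'_z' := p.U_z
  pure := p.pure'
  pure' := p.pure
  B_ne_zero := by rw [C.B_swap]; exact neg_ne_zero.mpr p.B_ne_zero

/-- The forms of type `(r, q - r)`: they are killed by `ℓ`, and vanish on arguments from `U` and `U'`
unless exactly `r` of them are in `U`. -/
def IsOfType {q : ℕ} (r : ℕ) (θ : E [⋀^Fin q]→ₗ[K] K) : Prop :=
  (∀ v : Fin q → E, (∃ i, v i = p.ℓ) → θ v = 0) ∧
    ∀ A : Finset (Fin q), A.card ≠ r → ∀ v : Fin q → E,
      (∀ i ∈ A, v i ∈ p.U) → (∀ i ∉ A, v i ∈ p.U') → θ v = 0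

theorem IsOfType.map_smul_ℓ {p : C.Polarization} {q r : ℕ} {θ : E [⋀^Fin q]→ₗ[K] K}
    (h : p.IsOfType r θ) {v : Fin q → E} {i : Fin q} {c : K} (hv : v i = c • p.ℓ) : θ v = 0 := by
  have h1 : v = Function.update v i (c • p.ℓ) := by rw [← hv, Function.update_eq_self]
  rw [h1, AlternatingMap.map_update_smul, h.1 _ ⟨i, Function.update_self _ _ _⟩, smul_zero]

/-- The Clifford endomorphism of a form of type `(r, q - r)` is a combination of Clifford products
of `r` vectors from `U'` and `q - r` vectors from `U`. -/
theorem endOfForm_mem_span {q r : ℕ} {θ : E [⋀^Fin q]→ₗ[K] K} (hθ : p.IsOfType r θ) :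
    C.endOfForm q θ ∈ Submodule.span K {X | ∃ (A : Finset (Fin q)) (n : Fin q → E),
      A.card = r ∧ (∀ i ∈ A, n i ∈ p.U') ∧ (∀ i ∉ A, n i ∈ p.U) ∧
      X = (List.ofFn fun i => C.γ (n i)).prod} := by
  let T : Fin 3 → Module.End K E := ![(C.η p.ℓ).smulRight p.ℓ, p.P, p.P']
  let T' : Fin 3 → Module.End K E := ![(C.η p.ℓ).smulRight p.ℓ, p.P', p.P]
  have hTT : ∀ t v w, C.η (T t v) w = C.η v (T' t w) := by
    intro t v w
    fin_cases t
    · simp [T, T', C.η_symm v p.ℓ, mul_comm]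
    · exact p.adjoint v w
    · exact p.symm.adjoint v w
  have hT : ∀ v, ∑ t, T t v = v := fun v => by
    rw [Fin.sum_univ_three]; exact p.sum_eq v
  let G : MultilinearMap K (fun _ : Fin q => E) (Module.End K M) :=
    (MultilinearMap.mkPiAlgebraFin K q (Module.End K M)).compLinearMap fun _ => C.γ
  have hG : ∀ v, G v = (List.ofFn fun i => C.γ (v i)).prod := fun v => by
    simp [G, MultilinearMap.mkPiAlgebraFin_apply]
  have h1 : C.endOfForm q θ = (-(32 * (q.factorial : K)))⁻¹ • ∑ τ : Fin q → Fin 3,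
      ∑ f : Fin q → Fin 11, ((∏ i, C.ε (f i)) * θ fun i => T (τ i) (C.b (f i))) •
        G (fun i => C.b (f i)) := by
    rw [endOfForm, Finset.sum_comm]
    congr 1
    refine Finset.sum_congr rfl fun f _ => ?_
    rw [← Finset.sum_smul, ← Finset.mul_sum, word_ofFn, hG]
    congr 2
    have h2 : (fun i => C.b (f i)) = fun i => ∑ t, T t (C.b (f i)) :=
      funext fun i => (hT _).symm
    conv_lhs => rw [h2]
    exact MultilinearMap.map_sum θ.toMultilinearMap fun i t => T t (C.b (f i))
  rw [h1]
  refine Submodule.smul_mem _ _ (Submodule.sum_mem _ fun τ _ => ?_)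
  by_cases h0 : ∃ i, τ i = 0
  · obtain ⟨i, hi⟩ := h0
    refine Submodule.sum_mem _ fun f _ => ?_
    rw [hθ.map_smul_ℓ (i := i) (c := C.η p.ℓ (C.b (f i))) (by simp [hi, T]), mul_zero, zero_smul]
    exact zero_mem _
  push Not at h0
  have hτ : ∀ i, τ i ≠ 1 → τ i = 2 := fun i hi => by
    have := h0 i
    revert hi this
    generalize τ i = t
    fin_cases t <;> simp
  let A : Finset (Fin q) := {i | τ i = 1}
  by_cases hA : A.card = r
  · have h2 := C.sum_form_adjoint θ.toMultilinearMap G (P := fun i => T (τ i))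
      (Q := fun i => T' (τ i)) (fun i => hTT (τ i))
    change ∑ f : Fin q → Fin 11, ((∏ i, C.ε (f i)) *
      θ.toMultilinearMap fun i => T (τ i) (C.b (f i))) • G (fun i => C.b (f i)) ∈ _
    rw [h2]
    refine Submodule.sum_mem _ fun f _ => Submodule.smul_mem _ _ (Submodule.subset_span
      ⟨A, fun i => T' (τ i) (C.b (f i)), hA, fun i hi => ?_, fun i hi => ?_, hG _⟩)
    · have : τ i = 1 := by simpa [A] using hi
      change T' (τ i) _ ∈ _
      rw [this]; exact p.P'_mem _
    · have : τ i ≠ 1 := by simpa [A] using hi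
      change T' (τ i) _ ∈ _
      rw [hτ i this]; exact p.P_mem _
  · refine Submodule.sum_mem _ fun f _ => ?_
    rw [hθ.2 A hA, mul_zero, zero_smul]
    · exact zero_mem _
    · intro i hi
      have : τ i = 1 := by simpa [A] using hi
      rw [this]; exact p.P_mem _
    · intro i hi
      have : τ i ≠ 1 := by simpa [A] using hi
      rw [hτ i this]; exact p.P'_mem _

end Polarization

theorem wedgeAction_one (v : Fin 1 → E) : wedgeAction C.γ 1 v = C.γ (v 0) := by
  rw [wedgeAction_apply]
  simp

theorem wedgeAction_two (v : Fin 2 → E) :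
    wedgeAction C.γ 2 v = C.γ (v 0) * C.γ (v 1) + C.η (v 0) (v 1) • (1 : Module.End K M) := by
  rw [wedgeAction_apply]
  have h := C.clifford (v 0) (v 1)
  have h1 : C.γ (v 1) * C.γ (v 0) =
      -(2 * C.η (v 0) (v 1)) • (1 : Module.End K M) - C.γ (v 0) * C.γ (v 1) :=
    eq_sub_of_add_eq' h
  have h2 : (Finset.univ : Finset (Equiv.Perm (Fin 2))) = {1, Equiv.swap 0 1} := by decide
  rw [h2, Finset.sum_pair (by decide), Equiv.Perm.sign_one,
    Equiv.Perm.sign_swap (by decide)]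
  simp only [List.ofFn_succ, List.ofFn_zero, List.prod_cons, List.prod_nil, mul_one, one_smul,
    Equiv.Perm.one_apply, Fin.succ_zero_eq_one, Equiv.swap_apply_left, Equiv.swap_apply_right,
    Units.neg_smul, h1, Nat.factorial_two, Nat.cast_ofNat]
  module

namespace Polarization

variable {C} (p : C.Polarization)

/-! ### The Fock filtration of a pure spinor -/

/-- The spinors obtained from `z` by Clifford multiplication with `k` vectors from `U'`. The level
`k` is an integer, and the negative levels are zero. -/
def level (k : ℤ) : Submodule K M :=
  Submodule.span K {x | ∃ l : List E, (∀ n ∈ l, n ∈ p.U') ∧ (l.length : ℤ) = k ∧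
    x = (l.map C.γ).prod p.z}

theorem eq_zero_of_mem_level {k : ℤ} (hk : k < 0) {y : M} (hy : y ∈ p.level k) : y = 0 := by
  induction hy using Submodule.span_induction with
  | mem x hx =>
    obtain ⟨l, -, hl, -⟩ := hx
    omega
  | zero => rfl
  | add x y _ _ hx hy => rw [hx, hy, add_zero]
  | smul c x _ hx => rw [hx, smul_zero]

theorem γ_U'_mem_level {k : ℤ} {n : E} (hn : n ∈ p.U') {y : M} (hy : y ∈ p.level k) :
    C.γ n y ∈ p.level (k + 1) := by
  induction hy using Submodule.span_induction with
  | mem x hx =>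
    obtain ⟨l, hl, hlk, rfl⟩ := hx
    refine Submodule.subset_span ⟨n :: l, ?_, by rw [List.length_cons]; push_cast; rw [hlk], ?_⟩
    · intro m hm
      rcases List.mem_cons.mp hm with rfl | hm
      exacts [hn, hl m hm]
    · rw [List.map_cons, List.prod_cons]; rfl
  | zero => rw [map_zero]; exact zero_mem _
  | add x y _ _ hx hy => rw [map_add]; exact add_mem hx hy
  | smul c x _ hx => rw [map_smul]; exact Submodule.smul_mem _ _ hx

theorem γ_U_mem_level {k : ℤ} {u : E} (hu : u ∈ p.U) {y : M} (hy : y ∈ p.level k) :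
    C.γ u y ∈ p.level (k - 1) := by
  induction hy using Submodule.span_induction with
  | mem x hx =>
    obtain ⟨l, hl, rfl, rfl⟩ := hx
    induction l with
    | nil => simp [p.U_z u hu]
    | cons n l ih =>
      have hn : n ∈ p.U' := hl n (by simp)
      have hl' : ∀ m ∈ l, m ∈ p.U' := fun m hm => hl m (List.mem_cons_of_mem _ hm)
      rw [List.map_cons, List.prod_cons, Module.End.mul_apply, C.clifford_apply]
      have h1 := p.γ_U'_mem_level hn (ih hl')
      have h2 : (l.map C.γ).prod p.z ∈ p.level (l.length : ℤ) :=
        Submodule.subset_span ⟨l, hl', rfl, rfl⟩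
      rw [sub_add_cancel] at h1
      have h3 : ((n :: l).length : ℤ) - 1 = l.length := by
        rw [List.length_cons]; push_cast; ring
      rw [h3]
      exact sub_mem (neg_mem h1) (Submodule.smul_mem _ _ h2)
  | zero => rw [map_zero]; exact zero_mem _
  | add x y _ _ hx hy => rw [map_add]; exact add_mem hx hy
  | smul c x _ hx => rw [map_smul]; exact Submodule.smul_mem _ _ hx

theorem prod_mem_level (q : ℕ) (n : Fin q → E) (d : Fin q → ℤ)
    (h : ∀ i, d i = 1 ∧ n i ∈ p.U' ∨ d i = -1 ∧ n i ∈ p.U) :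
    (List.ofFn fun i => C.γ (n i)).prod p.z ∈ p.level (∑ i, d i) := by
  induction q with
  | zero => exact Submodule.subset_span ⟨[], by simp, by simp, by simp⟩
  | succ q ih =>
    have h1 := ih (fun i => n i.succ) (fun i => d i.succ) fun i => h i.succ
    rw [List.ofFn_succ, List.prod_cons, Module.End.mul_apply, Fin.sum_univ_succ, add_comm]
    rcases h 0 with ⟨hd, hn⟩ | ⟨hd, hn⟩
    · rw [hd]; exact p.γ_U'_mem_level hn h1
    · rw [hd]; exact p.γ_U_mem_level hn h1

theorem endOfForm_z_mem_level {q r : ℕ} {θ : E [⋀^Fin q]→ₗ[K] K} (hθ : p.IsOfType r θ) :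
    C.endOfForm q θ p.z ∈ p.level (2 * r - q) := by
  have h := p.endOfForm_mem_span hθ
  generalize C.endOfForm q θ = X at h ⊢
  induction h using Submodule.span_induction with
  | mem X hX =>
    obtain ⟨A, n, hA, h1, h2, rfl⟩ := hX
    have h3 := p.prod_mem_level q n (fun i => if i ∈ A then 1 else -1) fun i => by
      by_cases hi : i ∈ A
      · exact Or.inl ⟨if_pos hi, h1 i hi⟩
      · exact Or.inr ⟨if_neg hi, h2 i hi⟩
    convert h3 using 2
    have h4 : ∀ i, (if i ∈ A then (1 : ℤ) else -1) = 2 * (if i ∈ A then 1 else 0) - 1 := by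
      intro i; split_ifs <;> norm_num
    simp_rw [h4]
    rw [Finset.sum_sub_distrib, ← Finset.mul_sum, Finset.sum_boole, Finset.sum_const]
    simp [hA]
  | zero => rw [LinearMap.zero_apply]; exact zero_mem _
  | add X Y _ _ hX hY => rw [LinearMap.add_apply]; exact add_mem hX hY
  | smul c X _ hX => rw [LinearMap.smul_apply]; exact Submodule.smul_mem _ _ hX

theorem IsOfType.symm {p : C.Polarization} {q r : ℕ} {θ : E [⋀^Fin q]→ₗ[K] K}
    (h : p.IsOfType r θ) (hr : r ≤ q) : p.symm.IsOfType (q - r) θ := by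
  refine ⟨h.1, fun A hA v h1 h2 => h.2 Aᶜ ?_ v (fun i hi => h2 i (by simpa using hi))
    fun i hi => h1 i (by simpa using hi)⟩
  have := A.card_le_univ
  rw [Fintype.card_fin] at this
  rw [Finset.card_compl, Fintype.card_fin]
  omega

theorem endOfForm_z'_eq_zero {q r : ℕ} {θ : E [⋀^Fin q]→ₗ[K] K} (hθ : p.IsOfType r θ)
    (hr : r ≤ q) (h : q < 2 * r) : C.endOfForm q θ p.z' = 0 :=
  p.symm.eq_zero_of_mem_level (by push_cast [hr]; omega)
    (p.symm.endOfForm_z_mem_level (hθ.symm hr))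

/-! ### Vanishing of spinor pairings -/

theorem γ_ℓ_γ {n : E} (hn : C.η p.ℓ n = 0) (y : M) :
    C.γ p.ℓ (C.γ n y) = -C.γ n (C.γ p.ℓ y) := by
  rw [C.clifford_apply, hn, mul_zero, zero_smul, sub_zero]

theorem γ_ℓ_prod {q : ℕ} {n : Fin q → E} (hn : ∀ i, C.η p.ℓ (n i) = 0) {y : M} {c : K}
    (hy : C.γ p.ℓ y = c • y) :
    C.γ p.ℓ ((List.ofFn fun i => C.γ (n i)).prod y) =
      ((-1) ^ q * c) • (List.ofFn fun i => C.γ (n i)).prod y := by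
  induction q with
  | zero => simp [hy]
  | succ q ih =>
    rw [List.ofFn_succ, List.prod_cons, Module.End.mul_apply, p.γ_ℓ_γ (hn 0),
      ih fun i => hn i.succ, map_smul, ← neg_smul]
    congr 1
    ring

theorem γ_ℓ_wedgeAction {q : ℕ} {n : Fin q → E} (hn : ∀ i, C.η p.ℓ (n i) = 0) {y : M} {c : K}
    (hy : C.γ p.ℓ y = c • y) :
    C.γ p.ℓ (wedgeAction C.γ q n y) = ((-1) ^ q * c) • wedgeAction C.γ q n y := by
  rw [wedgeAction_apply]
  simp only [LinearMap.smul_apply, LinearMap.sum_apply, map_smul, map_sum]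
  rw [smul_comm, Finset.smul_sum (r := (-1 : K) ^ q * c)]
  congr 1
  refine Finset.sum_congr rfl fun σ _ => ?_
  have h := p.γ_ℓ_prod (n := fun i => n (σ i)) (fun i => hn (σ i)) hy
  rcases Int.units_eq_one_or (Equiv.Perm.sign σ) with hs | hs
  · rw [hs, one_smul, h]
  · rw [hs, Units.neg_smul, one_smul, map_neg, h, smul_neg]

theorem γ_ℓ_endOfForm_z {q r : ℕ} {θ : E [⋀^Fin q]→ₗ[K] K} (hθ : p.IsOfType r θ) :
    C.γ p.ℓ (C.endOfForm q θ p.z) = ((-1) ^ q * p.ι) • C.endOfForm q θ p.z := by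
  have h := p.endOfForm_mem_span hθ
  generalize C.endOfForm q θ = X at h ⊢
  induction h using Submodule.span_induction with
  | mem X hX =>
    obtain ⟨A, n, hA, h1, h2, rfl⟩ := hX
    refine p.γ_ℓ_prod (fun i => ?_) p.ℓ_z
    by_cases hi : i ∈ A
    · exact p.U'_perp _ (h1 i hi)
    · exact p.U_perp _ (h2 i hi)
  | zero => simp
  | add X Y _ _ hX hY => rw [LinearMap.add_apply, map_add, hX, hY, smul_add]
  | smul c X _ hX => rw [LinearMap.smul_apply, map_smul, hX, smul_comm]

theorem B_z_of_even {y : M} (hy : C.γ p.ℓ y = p.ι • y) : C.B p.z y = 0 := by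
  have h := C.B_clifford p.ℓ p.z y
  rw [hy, p.ℓ_z, map_smul, map_smul, LinearMap.smul_apply, smul_eq_mul] at h
  exact (mul_eq_zero.mp (self_eq_neg.mp h)).resolve_left p.ι_ne_zero

theorem B_z'_of_odd {y : M} (hy : C.γ p.ℓ y = -p.ι • y) : C.B p.z' y = 0 :=
  p.symm.B_z_of_even hy

/-- The three-form of a pure spinor vanishes: reversing the three vectors changes the sign of the
leading part, and the remaining terms are of degree one. -/
theorem B_z_three {n₁ n₂ n₃ : E} (h₁ : C.η p.ℓ n₁ = 0) (h₂ : C.η p.ℓ n₂ = 0)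
    (h₃ : C.η p.ℓ n₃ = 0) : C.B p.z (C.γ n₁ (C.γ n₂ (C.γ n₃ p.z))) = 0 := by
  have h := C.B_swap p.z (C.γ n₁ (C.γ n₂ (C.γ n₃ p.z)))
  rw [C.B_clifford, C.B_clifford, C.B_clifford, neg_neg, neg_neg] at h
  have e₁ := congrArg (fun x => C.B p.z (C.γ n₃ x)) (C.clifford_apply n₂ n₁ p.z)
  have e₂ := congrArg (C.B p.z) (C.clifford_apply n₃ n₁ (C.γ n₂ p.z))
  have e₃ := congrArg (fun x => C.B p.z (C.γ n₁ x)) (C.clifford_apply n₃ n₂ p.z)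
  simp only [map_sub, map_neg, map_smul, smul_eq_mul, p.pure _ h₁, p.pure _ h₂, p.pure _ h₃,
    mul_zero, sub_zero] at e₁ e₂ e₃
  have h2 : (2 : K) * C.B p.z (C.γ n₁ (C.γ n₂ (C.γ n₃ p.z))) = 0 := by
    linear_combination h + e₁ - e₂ + e₃
  exact (mul_eq_zero.mp h2).resolve_left two_ne_zero

theorem B_z_level_one {y : M} (hy : y ∈ p.level 1) : C.B p.z y = 0 := by
  induction hy using Submodule.span_induction with
  | mem x hx =>
    obtain ⟨l, hl, hlk, rfl⟩ := hx
    obtain ⟨n, rfl⟩ := List.length_eq_one_iff.mp (by exact_mod_cast hlk : l.length = 1)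
    simpa using p.pure n (p.U'_perp n (hl n (by simp)))
  | zero => simp
  | add x y _ _ hx hy => rw [map_add, hx, hy, add_zero]
  | smul c x _ hx => rw [map_smul, hx, smul_zero]

theorem B_z_level_three {y : M} (hy : y ∈ p.level 3) : C.B p.z y = 0 := by
  induction hy using Submodule.span_induction with
  | mem x hx =>
    obtain ⟨l, hl, hlk, rfl⟩ := hx
    obtain ⟨n₁, n₂, n₃, rfl⟩ := List.length_eq_three.mp (by exact_mod_cast hlk : l.length = 3)
    simpa using p.B_z_three (p.U'_perp n₁ (hl _ (by simp))) (p.U'_perp n₂ (hl _ (by simp)))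
      (p.U'_perp n₃ (hl _ (by simp)))
  | zero => simp
  | add x y _ _ hx hy => rw [map_add, hx, hy, add_zero]
  | smul c x _ hx => rw [map_smul, hx, smul_zero]

theorem B_z'_level {k : ℤ} (hk : 0 < k) {y : M} (hy : y ∈ p.level k) : C.B p.z' y = 0 := by
  induction hy using Submodule.span_induction with
  | mem x hx =>
    obtain ⟨l, hl, hlk, rfl⟩ := hx
    cases l with
    | nil => simp at hlk; omega
    | cons n l =>
      have h := C.B_clifford n p.z' ((l.map C.γ).prod p.z)
      rw [p.U'_z' n (hl n (by simp)), map_zero, LinearMap.zero_apply] at h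
      rw [List.map_cons, List.prod_cons, Module.End.mul_apply]
      exact neg_eq_zero.mp h.symm
  | zero => simp
  | add x y _ _ hx hy => rw [map_add, hx, hy, add_zero]
  | smul c x _ hx => rw [map_smul, hx, smul_zero]

/-- Every vector is the sum of a multiple of `ℓ` and a vector orthogonal to `ℓ`. -/
theorem exists_eq_smul_add (v : E) : ∃ w, C.η p.ℓ w = 0 ∧ v = C.η p.ℓ v • p.ℓ + w :=
  ⟨v - C.η p.ℓ v • p.ℓ, by simp [p.η_ℓ], by abel⟩

/-- An odd spinor orthogonal to `z` has no Dirac current with `z`. -/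
theorem B_z_γ_of_odd {y : M} (hy : C.γ p.ℓ y = -p.ι • y) (h0 : C.B p.z y = 0) (v : E) :
    C.B p.z (C.γ v y) = 0 := by
  obtain ⟨w, hw, hv⟩ := p.exists_eq_smul_add v
  have h1 : C.B p.z (C.γ w y) = 0 := p.B_z_of_even (by
    rw [p.γ_ℓ_γ hw, hy, map_smul, neg_smul, neg_neg])
  rw [hv, map_add, LinearMap.add_apply, map_add, h1, add_zero, map_smul, LinearMap.smul_apply, hy]
  simp [h0]

theorem B_z'_γ_of_even {y : M} (hy : C.γ p.ℓ y = p.ι • y) (h0 : C.B p.z' y = 0) (v : E) :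
    C.B p.z' (C.γ v y) = 0 :=
  p.symm.B_z_γ_of_odd (hy.trans (congrArg (· • y) (neg_neg p.ι).symm)) h0 v

theorem B_z_γ_γ_level_one {y : M} (hy : y ∈ p.level 1) (v v' : E) :
    C.B p.z (C.γ v (C.γ v' y)) = 0 := by
  induction hy using Submodule.span_induction with
  | mem x hx =>
    obtain ⟨l, hl, hlk, rfl⟩ := hx
    obtain ⟨n, rfl⟩ := List.length_eq_one_iff.mp (by exact_mod_cast hlk : l.length = 1)
    have hn := p.U'_perp n (hl n (by simp))
    simp only [List.map_cons, List.map_nil, List.prod_cons, List.prod_nil, mul_one]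
    have hodd : C.γ p.ℓ (C.γ n p.z) = -p.ι • C.γ n p.z := by
      rw [p.γ_ℓ_γ hn, p.ℓ_z, map_smul, neg_smul]
    have h0 := p.pure n hn
    obtain ⟨w, hw, hv⟩ := p.exists_eq_smul_add v
    obtain ⟨w', hw', hv'⟩ := p.exists_eq_smul_add v'
    have h1 : ∀ m, C.B p.z (C.γ p.ℓ (C.γ m (C.γ n p.z))) = 0 := fun m => by
      have h := C.B_clifford p.ℓ p.z (C.γ m (C.γ n p.z))
      rw [p.ℓ_z, map_smul, LinearMap.smul_apply, p.B_z_γ_of_odd hodd h0, smul_zero] at h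
      exact neg_eq_zero.mp h.symm
    have h2 : ∀ m, C.B p.z (C.γ m (C.γ p.ℓ (C.γ n p.z))) = 0 := fun m => by
      rw [hodd, map_smul, map_smul, p.B_z_γ_of_odd hodd h0, smul_zero]
    rw [hv, hv']
    simp only [map_add, map_smul, LinearMap.add_apply, LinearMap.smul_apply, h1, h2, smul_zero,
      zero_add, p.B_z_three hw hw' hn]
  | zero => simp
  | add x y _ _ hx hy => simp only [map_add, hx, hy, add_zero]
  | smul c x _ hx => simp only [map_smul, hx, smul_zero]

end Polarization

/-- A two-form as a bilinear form. -/
def twoForm (θ : E [⋀^Fin 2]→ₗ[K] K) : LinearMap.BilinForm K E :=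
  have hsw : ∀ v w : E, θ ![w, v] = -θ ![v, w] := fun v w => by
    have h := θ.map_swap ![v, w] (show (0 : Fin 2) ≠ 1 by decide)
    rw [← h]
    congr 1
    ext i; fin_cases i <;> rfl
  LinearMap.mk₂ K (fun v w => θ ![v, w])
    (fun v v' w => θ.map_vecCons_add _ v v')
    (fun c v w => θ.map_vecCons_smul _ c v)
    (fun v w w' => by
      rw [hsw, θ.map_vecCons_add, hsw v w, hsw v w']
      ring)
    (fun c v w => by
      rw [hsw, θ.map_vecCons_smul, hsw v w, smul_neg, neg_neg])

theorem twoForm_apply (θ : E [⋀^Fin 2]→ₗ[K] K) (v w : E) : twoForm θ v w = θ ![v, w] := rfl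

theorem twoForm_swap (θ : E [⋀^Fin 2]→ₗ[K] K) (v w : E) : twoForm θ v w = -twoForm θ w v := by
  have h := θ.map_swap ![w, v] (show (0 : Fin 2) ≠ 1 by decide)
  rw [twoForm_apply, twoForm_apply, ← h]
  congr 1
  ext i; fin_cases i <;> rfl

theorem twoForm_eq_sum (θ : E [⋀^Fin 2]→ₗ[K] K) (v w : E) :
    twoForm θ v w = ∑ i, ∑ j, C.ε i * C.η v (C.b i) * (C.ε j * C.η w (C.b j)) *
      twoForm θ (C.b i) (C.b j) := by
  conv_lhs => rw [← C.sum_basis v, ← C.sum_basis w]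
  simp only [map_sum, map_smul, LinearMap.sum_apply, LinearMap.smul_apply, smul_eq_mul,
    Finset.mul_sum]
  rw [Finset.sum_comm]
  refine Finset.sum_congr rfl fun i _ => Finset.sum_congr rfl fun j _ => ?_
  ring

theorem endOfForm_two (θ : E [⋀^Fin 2]→ₗ[K] K) :
    C.endOfForm 2 θ = (-(64 : K))⁻¹ • ∑ i, ∑ j,
      (C.ε i * C.ε j * twoForm θ (C.b i) (C.b j)) • (C.g i * C.g j) := by
  rw [endOfForm, ← Equiv.sum_comp (finTwoArrowEquiv (Fin 11)).symm, Fintype.sum_prod_type]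
  congr 1
  · norm_num [Nat.factorial]
  · refine Finset.sum_congr rfl fun i _ => Finset.sum_congr rfl fun j _ => ?_
    have : (fun k => C.b ((finTwoArrowEquiv (Fin 11)).symm (i, j) k)) = ![C.b i, C.b j] := by
      ext1 k; fin_cases k <;> rfl
    rw [this, Fin.prod_univ_two, twoForm_apply]
    simp [List.ofFn_succ]

namespace Polarization

variable {C} (p : C.Polarization)

/-! ### Two-forms of type `(2, 0)` -/

theorem twoForm_eq_P_P {θ : E [⋀^Fin 2]→ₗ[K] K} (hθ : p.IsOfType 2 θ) (v w : E) :
    twoForm θ v w = twoForm θ (p.P v) (p.P w) := by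
  have hℓ : ∀ w, twoForm θ p.ℓ w = 0 := fun w => hθ.1 _ ⟨0, rfl⟩
  have h1 : ∀ u' ∈ p.U', ∀ u ∈ p.U, twoForm θ u' u = 0 := fun u' hu' u hu =>
    hθ.2 {1} (by simp) _ (by simpa using hu) (fun i hi => by
      fin_cases i
      · exact hu'
      · simp at hi)
  have h2 : ∀ u' ∈ p.U', ∀ w' ∈ p.U', twoForm θ u' w' = 0 := fun u' hu' w' hw' =>
    hθ.2 ∅ (by simp) _ (by simp) (fun i _ => by
      fin_cases i
      · exact hu'
      · exact hw')
  have h3 : ∀ v w, twoForm θ v w = twoForm θ (p.P v) w := fun v w => by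
    have h4 : twoForm θ (p.P' v) w = 0 := by
      conv_lhs => rw [← p.sum_eq w]
      rw [map_add, map_add, map_smul, twoForm_swap, hℓ, h1 _ (p.P'_mem v) _ (p.P_mem w),
        h2 _ (p.P'_mem v) _ (p.P'_mem w)]
      simp
    conv_lhs => rw [← p.sum_eq v]
    rw [map_add, map_add, map_smul, LinearMap.add_apply, LinearMap.add_apply,
      LinearMap.smul_apply, hℓ, h4]
    simp
  rw [h3, twoForm_swap, h3, twoForm_swap]
  simp

/-- Contracting the Clifford endomorphism of a two-form with two annihilators of `z`. -/
theorem γ_γ_endOfForm_two (θ : E [⋀^Fin 2]→ₗ[K] K) {u v : E} (hu : u ∈ p.U) (hv : v ∈ p.U) :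
    C.γ u (C.γ v (C.endOfForm 2 θ p.z)) = ((8 : K)⁻¹ * twoForm θ u v) • p.z := by
  have h1 : ∀ i j, C.γ u (C.γ v (C.g i (C.g j p.z))) =
      (4 * (C.η v (C.b i) * C.η u (C.b j) - C.η u (C.b i) * C.η v (C.b j))) • p.z := by
    intro i j
    have e : ∀ w ∈ p.U, ∀ k, C.γ w (C.g k p.z) = -((2 * C.η w (C.b k)) • p.z) := fun w hw k => by
      rw [g, C.clifford_apply, p.U_z w hw, map_zero, neg_zero, zero_sub]
    have e2 : C.γ v (C.g i (C.g j p.z)) =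
        -C.g i (C.γ v (C.g j p.z)) - (2 * C.η v (C.b i)) • C.g j p.z := C.clifford_apply _ _ _
    rw [e2, e v hv, map_sub, map_neg, map_neg, map_neg, map_smul, map_smul, map_smul, e u hu,
      e u hu]
    module
  rw [C.endOfForm_two]
  simp only [LinearMap.smul_apply, LinearMap.sum_apply, map_smul, map_sum, Module.End.mul_apply,
    h1]
  have h2 : (8 : K)⁻¹ * twoForm θ u v =
      (-(64 : K))⁻¹ * (4 * (twoForm θ v u - twoForm θ u v)) := by
    rw [twoForm_swap θ v u]; ring
  rw [h2, mul_smul]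
  congr 1
  rw [C.twoForm_eq_sum θ v u, C.twoForm_eq_sum θ u v, ← Finset.sum_sub_distrib, Finset.mul_sum,
    Finset.sum_smul]
  refine Finset.sum_congr rfl fun i _ => ?_
  rw [← Finset.sum_sub_distrib, Finset.mul_sum, Finset.sum_smul]
  refine Finset.sum_congr rfl fun j _ => ?_
  rw [smul_smul]
  congr 1
  ring

theorem B_z'_wedgeAction_two {θ : E [⋀^Fin 2]→ₗ[K] K} (hθ : p.IsOfType 2 θ) (v : Fin 2 → E) :
    C.B p.z' (wedgeAction C.γ 2 v (C.endOfForm 2 θ p.z)) =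
      (8 : K)⁻¹ * θ v * C.B p.z' p.z := by
  set y := C.endOfForm 2 θ p.z with hy
  have hlev : y ∈ p.level 2 := by
    have := p.endOfForm_z_mem_level hθ
    norm_num at this
    exact this
  have heven : C.γ p.ℓ y = p.ι • y := by
    have := p.γ_ℓ_endOfForm_z hθ
    rwa [neg_one_sq, one_mul] at this
  have h0 : C.B p.z' y = 0 := p.B_z'_level (by norm_num) hlev
  have hγ : ∀ v w, C.B p.z' (C.γ v (C.γ w y)) = -C.B (C.γ v p.z') (C.γ w y) := fun v w => by
    rw [C.B_clifford, neg_neg]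
  have hsw : ∀ v w, C.B p.z' (C.γ v (C.γ w y)) = -C.B p.z' (C.γ w (C.γ v y)) := fun v w => by
    rw [C.clifford_apply, map_sub, map_neg, map_smul, h0, smul_zero, sub_zero]
  have h3 : ∀ v w, C.B p.z' (C.γ v (C.γ w y)) = C.B p.z' (C.γ (p.P v) (C.γ w y)) := fun v w => by
    conv_lhs => rw [← p.sum_eq v]
    simp only [map_add, map_smul, LinearMap.add_apply, LinearMap.smul_apply]
    rw [hγ p.ℓ, p.ℓ_z', hγ (p.P' v), p.U'_z' _ (p.P'_mem v), map_smul, LinearMap.smul_apply,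
      p.B_z'_γ_of_even heven h0]
    simp
  have hv : θ v = twoForm θ (v 0) (v 1) := by
    rw [twoForm_apply]; congr 1; ext i; fin_cases i <;> rfl
  rw [C.wedgeAction_two, LinearMap.add_apply, LinearMap.smul_apply, Module.End.one_apply,
    Module.End.mul_apply, map_add, map_smul, h0, smul_zero, add_zero, h3, hsw, h3, hsw, neg_neg,
    p.γ_γ_endOfForm_two θ (p.P_mem _) (p.P_mem _), map_smul, smul_eq_mul, hv,
    p.twoForm_eq_P_P hθ (v 0) (v 1)]

/-! ### Bispinors in the Dirac kernel -/

theorem exists_of_two_form {θ : E [⋀^Fin 2]→ₗ[K] K} (hθ : p.IsOfType 2 θ) {s : M}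
    (hs : s = p.z + p.z') :
    ∃ ω ∈ Submodule.span K {ω | ∃ t : M, C.B s t = 0 ∧ ω = t ⊗ₜ[K] t},
      (∀ v, TensorProduct.lift C.B (LinearMap.lTensor M (wedgeAction C.γ 1 v) ω) = 0) ∧
      (∀ v, TensorProduct.lift C.B (LinearMap.lTensor M (wedgeAction C.γ 2 v) ω) = θ v) ∧
      (∀ w, (∀ i, C.η p.ℓ (w i) = 0) →
        TensorProduct.lift C.B (LinearMap.lTensor M (wedgeAction C.γ 5 w) ω) = 0) := by
  set X := C.endOfForm 2 θ with hX
  have hlev : X p.z ∈ p.level 2 := by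
    have := p.endOfForm_z_mem_level hθ
    norm_num at this
    exact this
  have heven : C.γ p.ℓ (X p.z) = p.ι • X p.z := by
    have := p.γ_ℓ_endOfForm_z hθ
    rwa [neg_one_sq, one_mul] at this
  have h0 : C.B p.z' (X p.z) = 0 := p.B_z'_level (by norm_num) hlev
  have hXs : X s = X p.z := by
    rw [hs, map_add, p.endOfForm_z'_eq_zero hθ le_rfl (by norm_num), add_zero]
  have hBs : C.B s p.z' = C.B p.z p.z' := by
    rw [hs, map_add, LinearMap.add_apply, C.B_self, add_zero]
  obtain ⟨ω, hω, hpair⟩ := C.exists_bispinor (C.endOfForm_skew (by decide) θ)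
    (s := s) (y := p.z') (by rw [hBs]; exact p.B_ne_zero) (by
      rw [hXs, hs, map_add, LinearMap.add_apply, p.B_z_of_even heven, h0, add_zero])
  rw [hBs, ← hX, hXs] at hpair
  have hne := p.B_ne_zero
  -- the projection away from `z` has left three quarters of `θ`
  refine ⟨(4 / 3 : K) • ω, Submodule.smul_mem _ _ hω, fun v => ?_, fun v => ?_, fun w hw => ?_⟩
  · rw [map_smul, map_smul, hpair _ (C.B_wedgeAction_symm (by decide) v),
      C.trace_wedgeAction_endOfForm_of_ne (by norm_num) (by norm_num), C.wedgeAction_one,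
      p.B_z'_γ_of_even heven h0]
    simp
  · rw [map_smul, map_smul, hpair _ (C.B_wedgeAction_symm (by decide) v),
      C.trace_wedgeAction_endOfForm (by decide) (by norm_num), p.B_z'_wedgeAction_two hθ,
      C.B_swap p.z' p.z, smul_eq_mul]
    field_simp
    ring
  · rw [map_smul, map_smul, hpair _ (C.B_wedgeAction_symm (by decide) w),
      C.trace_wedgeAction_endOfForm_of_ne (by norm_num) (by norm_num), p.B_z'_of_odd]
    · simp
    · rw [p.γ_ℓ_wedgeAction hw heven]
      norm_num

theorem exists_of_five_form {r : ℕ} (hr : r = 3 ∨ r = 4) {θ : E [⋀^Fin 5]→ₗ[K] K}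
    (hθ : p.IsOfType r θ) {s : M} (hs : s = p.z + p.z') :
    ∃ ω ∈ Submodule.span K {ω | ∃ t : M, C.B s t = 0 ∧ ω = t ⊗ₜ[K] t},
      (∀ v, TensorProduct.lift C.B (LinearMap.lTensor M (wedgeAction C.γ 1 v) ω) = 0) ∧
      (∀ v, (r = 3 ∨ ∃ i, v i = p.ℓ) →
        TensorProduct.lift C.B (LinearMap.lTensor M (wedgeAction C.γ 2 v) ω) = 0) ∧
      (∀ w, (∀ i, C.η p.ℓ (w i) = 0) →
        TensorProduct.lift C.B (LinearMap.lTensor M (wedgeAction C.γ 5 w) ω) = θ w) := by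
  set X := C.endOfForm 5 θ with hX
  have hodd : C.γ p.ℓ (X p.z) = -p.ι • X p.z := by
    have := p.γ_ℓ_endOfForm_z hθ
    rwa [Odd.neg_one_pow (by decide), neg_one_mul] at this
  have hlev : X p.z ∈ p.level (2 * r - (5 : ℕ)) := p.endOfForm_z_mem_level hθ
  have h0 : C.B p.z (X p.z) = 0 := by
    rcases hr with rfl | rfl
    · exact p.B_z_level_one (by simpa using hlev)
    · exact p.B_z_level_three (by simpa using hlev)
  have hXs : X s = X p.z := by
    rw [hs, map_add, p.endOfForm_z'_eq_zero hθ (by omega) (by omega), add_zero]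
  have hBs : C.B s p.z = -C.B p.z p.z' := by
    rw [hs, map_add, LinearMap.add_apply, C.B_self, zero_add, C.B_swap]
  obtain ⟨ω, hω, hpair⟩ := C.exists_bispinor (C.endOfForm_skew (by decide) θ)
    (s := s) (y := p.z) (by rw [hBs]; exact neg_ne_zero.mpr p.B_ne_zero) (by
      rw [hXs, hs, map_add, LinearMap.add_apply, h0, p.B_z'_of_odd hodd, add_zero])
  rw [← hX, hXs] at hpair
  refine ⟨ω, hω, fun v => ?_, fun v hv => ?_, fun w hw => ?_⟩
  · rw [hpair _ (C.B_wedgeAction_symm (by decide) v),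
      C.trace_wedgeAction_endOfForm_of_ne (by norm_num) (by norm_num), C.wedgeAction_one,
      p.B_z_γ_of_odd hodd h0]
    simp
  · have h2 : C.B p.z (C.γ (v 0) (C.γ (v 1) (X p.z))) = 0 := by
      rcases hv with rfl | ⟨i, hi⟩
      · exact p.B_z_γ_γ_level_one (by simpa using hlev) _ _
      · fin_cases i
        · have h := C.B_clifford p.ℓ p.z (C.γ (v 1) (X p.z))
          rw [p.ℓ_z, map_smul, LinearMap.smul_apply, p.B_z_γ_of_odd hodd h0, smul_zero] at h
          change v 0 = p.ℓ at hi
          rw [hi]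
          exact neg_eq_zero.mp h.symm
        · change v 1 = p.ℓ at hi
          rw [hi, hodd, map_smul, map_smul, p.B_z_γ_of_odd hodd h0, smul_zero]
    rw [hpair _ (C.B_wedgeAction_symm (by decide) v),
      C.trace_wedgeAction_endOfForm_of_ne (by norm_num) (by norm_num), C.wedgeAction_two,
      LinearMap.add_apply, LinearMap.smul_apply, Module.End.one_apply, Module.End.mul_apply,
      map_add, h2, map_smul, h0]
    simp
  · rw [hpair _ (C.B_wedgeAction_symm (by decide) w),
      C.trace_wedgeAction_endOfForm (by decide) (by norm_num), p.B_z_of_even]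
    · simp
    · rw [p.γ_ℓ_wedgeAction hw hodd]
      norm_num

end Polarization
end CliffordSpinors

namespace SpinorData

variable {V S : Type*} [AddCommGroup V] [Module ℝ V] [AddCommGroup S] [Module ℝ S]
  (D : SpinorData V S)

/-! ### The real and the complexified spinor modules -/

/-- The real spinors as a Clifford module with an orthonormal basis. -/
def realSpinors : CliffordSpinors ℝ V S :=
  have hη : ∀ v w, D.η v w = D.η w v := fun v w => by
    have h : D.η = D.η.flip := D.lorentzian.choose.ext fun i => D.lorentzian.choose.ext fun j => by
      have h := D.lorentzian.choose_spec
      change D.η _ _ = D.η _ _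
      rw [h, h]
      by_cases hij : i = j
      · rw [hij]
      · rw [if_neg hij, if_neg (Ne.symm hij)]
    exact LinearMap.congr_fun₂ h v w
  { η := D.η
    γ := D.γ
    B := D.B
    b := D.lorentzian.choose
    ε := fun i => if i = 0 then 1 else -1
    ε_sq := fun i => by split_ifs <;> norm_num
    η_basis := D.lorentzian.choose_spec
    η_symm := hη
    clifford := fun v w => by
      have h := D.γ_sq (v + w)
      simp only [map_add, LinearMap.add_apply, add_mul, mul_add, D.γ_sq, hη w v] at h
      have h2 : D.γ v * D.γ w + D.γ w * D.γ v =
          (-D.η v v • (1 : Module.End ℝ S) + D.γ w * D.γ v +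
            (D.γ v * D.γ w + -D.η w w • (1 : Module.End ℝ S))) +
          (D.η v v + D.η w w) • (1 : Module.End ℝ S) := by module
      rw [h2, h]
      module
    finrank_eq := D.finrank_spinors
    B_swap := fun x y => (D.B_alt.neg_eq y x).symm
    B_nondegenerate := D.B_nondegenerate
    B_clifford := D.B_clifford }

theorem exists_eq_add_I_tmul (x : ℂ ⊗[ℝ] S) :
    ∃ a b : S, x = (1 : ℂ) ⊗ₜ[ℝ] a + Complex.I ⊗ₜ[ℝ] b := by
  induction x using TensorProduct.induction_on with
  | zero => exact ⟨0, 0, by simp⟩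
  | tmul c t =>
    refine ⟨c.re • t, c.im • t, ?_⟩
    rw [TensorProduct.tmul_smul, TensorProduct.tmul_smul, TensorProduct.smul_tmul',
      TensorProduct.smul_tmul', ← TensorProduct.add_tmul]
    congr 1
    rw [Complex.real_smul, Complex.real_smul, mul_one, Complex.re_add_im]
  | add x y hx hy =>
    obtain ⟨a, b, rfl⟩ := hx
    obtain ⟨a', b', rfl⟩ := hy
    refine ⟨a + a', b + b', ?_⟩
    rw [TensorProduct.tmul_add, TensorProduct.tmul_add]
    abel

theorem γC_tmul (c d : ℂ) (v : V) (t : S) :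
    D.γC (c ⊗ₜ v) (d ⊗ₜ t) = (c * d) ⊗ₜ[ℝ] D.γ v t := by
  rw [γC, LinearMap.liftBaseChange_tmul, LinearMap.smul_apply]
  change c • (D.γ v).baseChange ℂ (d ⊗ₜ t) = _
  rw [LinearMap.baseChange_tmul, TensorProduct.smul_tmul', smul_eq_mul]

theorem BC_tmul (c d : ℂ) (s t : S) :
    D.BC (c ⊗ₜ s) (d ⊗ₜ t) = (D.B s t : ℂ) * (c * d) := by
  rw [BC, LinearMap.BilinForm.baseChange_tmul, Complex.real_smul]

theorem BC_swap (x y : ℂ ⊗[ℝ] S) : D.BC x y = -D.BC y x := by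
  induction x using TensorProduct.induction_on with
  | zero => simp
  | add x x' hx hx' => rw [map_add, LinearMap.add_apply, hx, hx', map_add]; ring
  | tmul c s =>
    induction y using TensorProduct.induction_on with
    | zero => simp
    | add y y' hy hy' => rw [map_add, hy, hy', map_add, LinearMap.add_apply]; ring
    | tmul d t =>
      rw [BC_tmul, BC_tmul, show D.B s t = -D.B t s from D.realSpinors.B_swap s t]
      push_cast
      ring

theorem BC_nondegenerate : D.BC.Nondegenerate := by
  have key : ∀ x, (∀ y, D.BC x y = 0) → x = 0 := by
    intro x hx
    obtain ⟨a, b, rfl⟩ := exists_eq_add_I_tmul x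
    have h : ∀ t, D.B a t = 0 ∧ D.B b t = 0 := fun t => by
      have h := hx ((1 : ℂ) ⊗ₜ t)
      rw [map_add, LinearMap.add_apply, BC_tmul, BC_tmul] at h
      have h1 := congrArg Complex.re h
      have h2 := congrArg Complex.im h
      simp at h1 h2
      exact ⟨h1, h2⟩
    rw [D.B_nondegenerate.1 a fun t => (h t).1, D.B_nondegenerate.1 b fun t => (h t).2]
    simp
  exact ⟨key, fun y hy => key y fun x => by rw [BC_swap, hy, neg_zero]⟩

/-- The Dirac spinors as a Clifford module over the complex numbers. -/
def complexSpinors : CliffordSpinors ℂ (ℂ ⊗[ℝ] V) (ℂ ⊗[ℝ] S) where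
  η := D.η.baseChange ℂ
  γ := D.γC
  B := D.BC
  b := Algebra.TensorProduct.basis ℂ D.realSpinors.b
  ε i := (D.realSpinors.ε i : ℂ)
  ε_sq i := by exact_mod_cast congrArg Complex.ofReal (D.realSpinors.ε_sq i)
  η_basis i j := by
    rw [Algebra.TensorProduct.basis_apply, Algebra.TensorProduct.basis_apply,
      LinearMap.BilinForm.baseChange_tmul]
    change D.realSpinors.η _ _ • _ = _
    rw [D.realSpinors.η_basis]
    split_ifs <;> simp
  η_symm v w := (LinearMap.BilinForm.IsSymm.baseChange ℂ ⟨D.realSpinors.η_symm⟩).eq v w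
  clifford v w := by
    have h1 : ∀ (v w : V) (t : S), D.γ v (D.γ w t) + D.γ w (D.γ v t) = -(2 * D.η v w) • t :=
      fun v w t => congrArg (fun X : Module.End ℝ S => X t) (D.realSpinors.clifford v w)
    refine LinearMap.ext fun x => ?_
    simp only [LinearMap.add_apply, Module.End.mul_apply, LinearMap.smul_apply,
      Module.End.one_apply]
    induction x using TensorProduct.induction_on with
    | zero => simp
    | add x x' hx hx' =>
      simp only [map_add, smul_add, ← hx, ← hx']
      abel
    | tmul e t =>
      induction v using TensorProduct.induction_on with
      | zero => simp
      | add v v' hv hv' =>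
        simp only [map_add, LinearMap.add_apply, mul_add, neg_add, add_smul]
        rw [← hv, ← hv']
        abel
      | tmul c v =>
        induction w using TensorProduct.induction_on with
        | zero => simp
        | add w w' hw hw' =>
          simp only [map_add, LinearMap.add_apply, mul_add, neg_add, add_smul]
          rw [← hw, ← hw']
          abel
        | tmul d w =>
          rw [γC_tmul, γC_tmul, γC_tmul, γC_tmul, mul_left_comm d, ← TensorProduct.tmul_add, h1,
            LinearMap.BilinForm.baseChange_tmul, TensorProduct.tmul_smul,
            TensorProduct.smul_tmul', TensorProduct.smul_tmul']
          congr 1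
          rw [Complex.real_smul, Complex.real_smul, smul_eq_mul]
          push_cast
          ring
  finrank_eq := by rw [Module.finrank_baseChange, D.finrank_spinors]
  B_swap := D.BC_swap
  B_nondegenerate := D.BC_nondegenerate
  B_clifford v x y := by
    induction v using TensorProduct.induction_on with
    | zero => simp
    | add v v' hv hv' =>
      rw [map_add, LinearMap.add_apply, LinearMap.add_apply, map_add, map_add,
        LinearMap.add_apply, hv, hv']
      ring
    | tmul e v =>
      induction x using TensorProduct.induction_on with
      | zero => simp
      | add x x' hx hx' =>
        rw [map_add, map_add, LinearMap.add_apply, map_add, LinearMap.add_apply, hx, hx']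
        ring
      | tmul c s =>
        induction y using TensorProduct.induction_on with
        | zero => simp
        | add y y' hy hy' => rw [map_add, map_add, map_add, hy, hy']; ring
        | tmul d t =>
          have h : D.B (D.γ v s) t = -D.B s (D.γ v t) := D.B_clifford v s t
          rw [γC_tmul, γC_tmul, BC_tmul, BC_tmul, h]
          push_cast
          ring

/-! ### The polarization of a spinor with timelike Dirac current -/

theorem B_self (s : S) : D.B s s = 0 := D.B_alt s

theorem B_γ (v : V) (s t : S) : D.B (D.γ v s) t = -D.B s (D.γ v t) := D.B_clifford v s t

theorem γ_γ (v w : V) (t : S) : D.γ v (D.γ w t) = -D.γ w (D.γ v t) - (2 * D.η v w) • t :=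
  D.realSpinors.clifford_apply v w t

theorem η_symm (v w : V) : D.η v w = D.η w v := D.realSpinors.η_symm v w

theorem spinorForm_two (s : S) (v w : V) : D.spinorForm 2 s ![v, w] = D.B s (D.γ v (D.γ w s)) := by
  have h := D.realSpinors.wedgeAction_two ![v, w]
  change D.B s (wedgeAction D.realSpinors.γ 2 ![v, w] s) = _
  rw [h]
  change D.B s (D.γ v (D.γ w s) + D.η v w • s) = _
  rw [map_add, map_smul, D.B_self, smul_zero, add_zero]

variable (s : S)

/-- The length of the Dirac current. -/
def currentNorm : ℝ := Real.sqrt (D.η (D.diracCurrent s s) (D.diracCurrent s s))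

theorem η_complexStructure' (v w : V) : D.η (D.complexStructure s v) w =
    (D.currentNorm s)⁻¹ * D.B s (D.γ v (D.γ w s)) := by
  rw [η_complexStructure, spinorForm_two, currentNorm]

/-- The complex structure as a linear map. -/
def complexStructureHom : V →ₗ[ℝ] V :=
  IsLinearMap.mk' (D.complexStructure s)
    ⟨fun v v' => sub_eq_zero.mp (D.realSpinors.eq_zero_of_η _ fun w => by
      change D.η (D.complexStructure s (v + v') - (D.complexStructure s v +
        D.complexStructure s v')) w = 0
      simp only [map_sub, map_add, LinearMap.sub_apply, LinearMap.add_apply,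
        η_complexStructure']
      ring),
    fun c v => sub_eq_zero.mp (D.realSpinors.eq_zero_of_η _ fun w => by
      change D.η (D.complexStructure s (c • v) - c • D.complexStructure s v) w = 0
      simp only [map_sub, map_smul, LinearMap.sub_apply, LinearMap.smul_apply,
        η_complexStructure', smul_eq_mul]
      ring)⟩

theorem complexStructureHom_apply (v : V) :
    D.complexStructureHom s v = D.complexStructure s v := rfl

theorem η_complexStructure_swap (v w : V) :
    D.η (D.complexStructure s v) w = -D.η v (D.complexStructure s w) := by
  rw [D.η_symm v, η_complexStructure', η_complexStructure', D.γ_γ v w, map_sub, map_neg, map_smul,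
    D.B_self]
  simp

variable {s} (hs : 0 < D.η (D.diracCurrent s s) (D.diracCurrent s s))
include hs

theorem currentNorm_pos : 0 < D.currentNorm s := Real.sqrt_pos.mpr hs

theorem currentNorm_sq : D.currentNorm s * D.currentNorm s =
    D.η (D.diracCurrent s s) (D.diracCurrent s s) := Real.mul_self_sqrt hs.le

/-- The Fierz identity in terms of the complex structure. -/
theorem γ_complexStructure (v : V) : D.currentNorm s • D.γ (D.complexStructure s v) s =
    D.γ (D.diracCurrent s s) (D.γ v s) + D.η (D.diracCurrent s s) v • s := by
  have h := D.realSpinors.fierz_two_form s (D.diracCurrent s s)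
    (fun w => D.η_diracCurrent s s w) (D.currentNorm s • D.complexStructure s v) v (fun w => by
      change D.η (D.currentNorm s • D.complexStructure s v) w = D.B s (D.γ v (D.γ w s))
      rw [map_smul, LinearMap.smul_apply, η_complexStructure', smul_eq_mul,
        mul_inv_cancel_left₀ (D.currentNorm_pos hs).ne'])
  rw [← LinearMap.smul_apply, ← map_smul]
  exact h

/-- No nonzero vector annihilates a spinor with timelike Dirac current. -/
theorem eq_zero_of_γ_eq_zero {v : V} (hv : D.γ v s = 0) : v = 0 := by
  refine D.realSpinors.eq_zero_of_η v fun w => ?_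
  change D.η v w = 0
  have h0 : D.η v (D.diracCurrent s s) = 0 := by
    rw [D.η_symm, η_diracCurrent, hv, map_zero]
  have h1 : D.γ v (D.γ w s) = -((2 * D.η v w) • s) := by
    rw [D.γ_γ, hv, map_zero, neg_zero, zero_sub]
  have h2 : D.γ v (D.γ (D.diracCurrent s s) s) = 0 := by
    rw [D.γ_γ, hv, map_zero, h0]
    simp
  have h3 : D.B s (D.γ (D.diracCurrent s s) (D.γ v (D.γ w s))) = 0 := by
    have h4 := D.B_γ (D.diracCurrent s s) s (D.γ v (D.γ w s))
    have h5 := D.B_γ v (D.γ (D.diracCurrent s s) s) (D.γ w s)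
    rw [h2, map_zero, LinearMap.zero_apply] at h5
    linarith
  rw [h1, map_neg, map_smul, map_neg, map_smul, ← η_diracCurrent, smul_eq_mul, neg_eq_zero] at h3
  have h4 := (mul_eq_zero.mp h3).resolve_right hs.ne'
  linarith

theorem complexStructure_diracCurrent : D.complexStructure s (D.diracCurrent s s) = 0 := by
  refine D.eq_zero_of_γ_eq_zero hs ?_
  have h := D.γ_complexStructure hs (D.diracCurrent s s)
  have h2 : D.γ (D.diracCurrent s s) (D.γ (D.diracCurrent s s) s) =
      -(D.η (D.diracCurrent s s) (D.diracCurrent s s)) • s :=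
    congrArg (fun X : Module.End ℝ S => X s) (D.γ_sq (D.diracCurrent s s))
  rw [h2, ← add_smul, neg_add_cancel, zero_smul] at h
  exact (smul_eq_zero.mp h).resolve_left (D.currentNorm_pos hs).ne'

theorem η_diracCurrent_complexStructure (v : V) :
    D.η (D.diracCurrent s s) (D.complexStructure s v) = 0 := by
  have h := D.η_complexStructure_swap s (D.diracCurrent s s) v
  rw [D.complexStructure_diracCurrent hs, map_zero, LinearMap.zero_apply] at h
  linarith

omit hs

/-- The normalised Dirac current. -/
def unitCurrent (s : S) : V := (D.currentNorm s)⁻¹ • D.diracCurrent s s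

theorem η_unitCurrent_eq_zero {w : V} (hw : D.η (D.diracCurrent s s) w = 0) :
    D.η (D.unitCurrent s) w = 0 := by
  rw [unitCurrent, map_smul, LinearMap.smul_apply, hw, smul_zero]

theorem γ_unitCurrent_γ {w : V} (hw : D.η (D.diracCurrent s s) w = 0) (t : S) :
    D.γ (D.unitCurrent s) (D.γ w t) = -D.γ w (D.γ (D.unitCurrent s) t) := by
  rw [D.γ_γ, D.η_unitCurrent_eq_zero hw, mul_zero, zero_smul, sub_zero]

include hs

theorem η_unitCurrent_self : D.η (D.unitCurrent s) (D.unitCurrent s) = 1 := by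
  have h := (D.currentNorm_pos hs).ne'
  simp only [unitCurrent, map_smul, LinearMap.smul_apply, smul_eq_mul, ← D.currentNorm_sq hs]
  field_simp

theorem γ_unitCurrent_sq (t : S) : D.γ (D.unitCurrent s) (D.γ (D.unitCurrent s) t) = -t := by
  have h := congrArg (fun X : Module.End ℝ S => X t) (D.γ_sq (D.unitCurrent s))
  rw [D.η_unitCurrent_self hs] at h
  simpa using h

theorem γ_complexStructure_of_orthogonal {w : V} (hw : D.η (D.diracCurrent s s) w = 0) :
    D.γ (D.complexStructure s w) s = D.γ (D.unitCurrent s) (D.γ w s) := by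
  have h := D.γ_complexStructure hs w
  rw [hw, zero_smul, add_zero] at h
  rw [unitCurrent, map_smul, LinearMap.smul_apply, ← h, smul_smul,
    inv_mul_cancel₀ (D.currentNorm_pos hs).ne', one_smul]

theorem γ_complexStructure_γ_unitCurrent {w : V} (hw : D.η (D.diracCurrent s s) w = 0) :
    D.γ (D.complexStructure s w) (D.γ (D.unitCurrent s) s) = D.γ w s := by
  have h := D.γ_unitCurrent_γ (D.η_diracCurrent_complexStructure hs w) s
  rw [D.γ_complexStructure_of_orthogonal hs hw, D.γ_unitCurrent_sq hs] at h
  exact neg_injective h.symm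

theorem B_γ_unitCurrent_pos : 0 < D.B s (D.γ (D.unitCurrent s) s) := by
  rw [← η_diracCurrent, unitCurrent, map_smul, smul_eq_mul]
  exact mul_pos (inv_pos.mpr (D.currentNorm_pos hs)) hs

omit hs

/-- The component `(s - κ ξ̂ · s)/2` of the spinor `s`, where `ξ̂` is the normalised Dirac current.
For `κ = ±i` it is an eigenvector of `ξ̂`, with eigenvalue `κ`. -/
def chiralPart (s : S) (κ : ℂ) : ℂ ⊗[ℝ] S :=
  (1 / 2 : ℂ) • ((1 : ℂ) ⊗ₜ[ℝ] s - κ ⊗ₜ[ℝ] D.γ (D.unitCurrent s) s)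

/-- The vectors `(w - κ J w)/2` with `w ∈ ξ^⊥`; for `κ = ±i` they span `W¹⁰` and `W⁰¹`. -/
def typeVector (s : S) (κ : ℂ) (w : V) : ℂ ⊗[ℝ] V :=
  (1 / 2 : ℂ) • ((1 : ℂ) ⊗ₜ[ℝ] w - κ ⊗ₜ[ℝ] D.complexStructure s w)

include hs

theorem γC_unitCurrent_chiralPart {κ : ℂ} (hκ : κ * κ = -1) :
    D.γC ((1 : ℂ) ⊗ₜ D.unitCurrent s) (D.chiralPart s κ) = κ • D.chiralPart s κ := by
  have h : κ • ((1 : ℂ) ⊗ₜ[ℝ] s - κ ⊗ₜ[ℝ] D.γ (D.unitCurrent s) s) =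
      κ ⊗ₜ[ℝ] s + (1 : ℂ) ⊗ₜ[ℝ] D.γ (D.unitCurrent s) s := by
    rw [smul_sub, TensorProduct.smul_tmul', TensorProduct.smul_tmul', smul_eq_mul, smul_eq_mul,
      hκ, TensorProduct.neg_tmul, mul_one, sub_neg_eq_add]
  rw [chiralPart, map_smul, smul_comm κ, h, map_sub, γC_tmul, γC_tmul, D.γ_unitCurrent_sq hs,
    TensorProduct.tmul_neg, sub_neg_eq_add, one_mul, one_mul, add_comm]

theorem γC_typeVector_chiralPart {κ : ℂ} (hκ : κ * κ = -1) {w : V}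
    (hw : D.η (D.diracCurrent s s) w = 0) :
    D.γC (D.typeVector s κ w) (D.chiralPart s κ) = 0 := by
  have h1 : D.γ w (D.γ (D.unitCurrent s) s) = -D.γ (D.unitCurrent s) (D.γ w s) := by
    rw [D.γ_unitCurrent_γ hw, neg_neg]
  simp only [typeVector, chiralPart, map_smul, LinearMap.smul_apply, map_sub,
    LinearMap.sub_apply, γC_tmul, hκ, h1, D.γ_complexStructure_of_orthogonal hs hw,
    D.γ_complexStructure_γ_unitCurrent hs hw, TensorProduct.tmul_neg, TensorProduct.neg_tmul,
    one_mul, mul_one]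
  module

theorem B_γ_γ_unitCurrent {w : V} (hw : D.η (D.diracCurrent s s) w = 0) :
    D.B s (D.γ w (D.γ (D.unitCurrent s) s)) = 0 := by
  have h := D.γ_unitCurrent_γ hw s
  rw [← neg_eq_zero, ← map_neg, ← h, ← D.γ_complexStructure_of_orthogonal hs hw,
    ← η_diracCurrent, D.η_diracCurrent_complexStructure hs]

theorem BC_chiralPart_γC_tmul {κ : ℂ} {w : V}
    (hw : D.η (D.diracCurrent s s) w = 0) (c : ℂ) :
    D.BC (D.chiralPart s κ) (D.γC (c ⊗ₜ w) (D.chiralPart s κ)) = 0 := by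
  have h1 : D.B s (D.γ w s) = 0 := by rw [← η_diracCurrent, hw]
  have h2 := D.B_γ_γ_unitCurrent hs hw
  have h3 : D.B (D.γ (D.unitCurrent s) s) (D.γ w s) = 0 := by
    rw [B_γ, D.γ_unitCurrent_γ hw, map_neg, h2, neg_zero, neg_zero]
  have h4 : D.B (D.γ (D.unitCurrent s) s) (D.γ w (D.γ (D.unitCurrent s) s)) = 0 := by
    rw [B_γ, D.γ_unitCurrent_γ hw, D.γ_unitCurrent_sq hs, map_neg, map_neg, map_neg, h1]
    simp
  rw [chiralPart]
  simp only [map_smul, map_sub, LinearMap.smul_apply, LinearMap.sub_apply, γC_tmul, BC_tmul,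
    h1, h2, h3, h4]
  simp

theorem BC_chiralPart_chiralPart :
    D.BC (D.chiralPart s Complex.I) (D.chiralPart s (-Complex.I)) ≠ 0 := by
  have h2 : D.B (D.γ (D.unitCurrent s) s) s = -D.B s (D.γ (D.unitCurrent s) s) := D.B_γ _ _ _
  have hpos := D.B_γ_unitCurrent_pos hs
  rw [chiralPart, chiralPart]
  simp only [map_smul, map_sub, LinearMap.smul_apply, LinearMap.sub_apply, BC_tmul, D.B_self,
    h2]
  intro h
  have h3 := congrArg Complex.im h
  simp at h3
  linarith

theorem η_tmul_unitCurrent_typeVector {κ : ℂ} {w : V} (hw : D.η (D.diracCurrent s s) w = 0) :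
    D.complexSpinors.η ((1 : ℂ) ⊗ₜ D.unitCurrent s) (D.typeVector s κ w) = 0 := by
  change D.η.baseChange ℂ _ _ = 0
  rw [typeVector, map_smul, map_sub, LinearMap.BilinForm.baseChange_tmul,
    LinearMap.BilinForm.baseChange_tmul, D.η_unitCurrent_eq_zero hw,
    D.η_unitCurrent_eq_zero (D.η_diracCurrent_complexStructure hs w)]
  simp

omit hs

/-- The projection `v ↦ (v - η(ξ̂,v) ξ̂ - κ J v)/2` onto the vectors `typeVector`. -/
def typeProj (s : S) (κ : ℂ) : Module.End ℂ (ℂ ⊗[ℝ] V) :=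
  (1 / 2 : ℂ) • (LinearMap.id -
    (D.complexSpinors.η ((1 : ℂ) ⊗ₜ D.unitCurrent s)).smulRight ((1 : ℂ) ⊗ₜ D.unitCurrent s) -
    κ • (D.complexStructureHom s).baseChange ℂ)

theorem typeProj_apply (κ : ℂ) (v : ℂ ⊗[ℝ] V) : D.typeProj s κ v = (1 / 2 : ℂ) • (v -
    D.complexSpinors.η ((1 : ℂ) ⊗ₜ D.unitCurrent s) v • ((1 : ℂ) ⊗ₜ D.unitCurrent s) -
    κ • (D.complexStructureHom s).baseChange ℂ v) := rfl

theorem η_baseChange_complexStructure (v w : ℂ ⊗[ℝ] V) :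
    D.complexSpinors.η ((D.complexStructureHom s).baseChange ℂ v) w =
      -D.complexSpinors.η v ((D.complexStructureHom s).baseChange ℂ w) := by
  change D.η.baseChange ℂ _ _ = -D.η.baseChange ℂ _ _
  induction v using TensorProduct.induction_on with
  | zero => simp
  | add v v' hv hv' =>
    rw [map_add, map_add, LinearMap.add_apply, hv, hv', map_add, LinearMap.add_apply]; ring
  | tmul c v =>
    induction w using TensorProduct.induction_on with
    | zero => simp
    | add w w' hw hw' => rw [map_add, hw, hw', map_add, map_add]; ring
    | tmul d w =>
      rw [LinearMap.baseChange_tmul, LinearMap.baseChange_tmul,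
        LinearMap.BilinForm.baseChange_tmul, LinearMap.BilinForm.baseChange_tmul,
        complexStructureHom_apply, complexStructureHom_apply, D.η_complexStructure_swap, neg_smul]

theorem η_typeProj (v w : ℂ ⊗[ℝ] V) :
    D.complexSpinors.η (D.typeProj s Complex.I v) w =
      D.complexSpinors.η v (D.typeProj s (-Complex.I) w) := by
  simp only [typeProj_apply, map_smul, map_sub, LinearMap.smul_apply, LinearMap.sub_apply,
    smul_eq_mul, D.η_baseChange_complexStructure,
    D.complexSpinors.η_symm v ((1 : ℂ) ⊗ₜ D.unitCurrent s)]
  ring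

include hs

theorem typeProj_tmul (κ c : ℂ) (r : V) : ∃ w, D.η (D.diracCurrent s s) w = 0 ∧
    D.typeProj s κ (c ⊗ₜ r) = c • D.typeVector s κ w := by
  refine ⟨r - D.η (D.unitCurrent s) r • D.unitCurrent s, ?_, ?_⟩
  · have h : D.diracCurrent s s = D.currentNorm s • D.unitCurrent s := by
      rw [unitCurrent, smul_smul, mul_inv_cancel₀ (D.currentNorm_pos hs).ne', one_smul]
    rw [h, map_smul, LinearMap.smul_apply, map_sub, map_smul, D.η_unitCurrent_self hs]
    simp
  · have h1 : D.complexStructureHom s (D.unitCurrent s) = 0 := by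
      rw [unitCurrent, map_smul, complexStructureHom_apply, D.complexStructure_diracCurrent hs,
        smul_zero]
    have h2 : D.complexStructure s (r - D.η (D.unitCurrent s) r • D.unitCurrent s) =
        D.complexStructure s r := by
      rw [← complexStructureHom_apply, map_sub, map_smul, h1, smul_zero, sub_zero,
        complexStructureHom_apply]
    rw [typeProj_apply, typeVector, h2, smul_comm c]
    congr 1
    rw [LinearMap.baseChange_tmul, complexStructureHom_apply, TensorProduct.tmul_sub, smul_sub,
      smul_sub, TensorProduct.smul_tmul', TensorProduct.smul_tmul', TensorProduct.smul_tmul',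
      TensorProduct.tmul_smul, TensorProduct.smul_tmul', TensorProduct.smul_tmul',
      TensorProduct.smul_tmul']
    change _ - (D.η.baseChange ℂ _ _ • (1 : ℂ)) ⊗ₜ[ℝ] _ - _ = _
    rw [LinearMap.BilinForm.baseChange_tmul]
    simp only [smul_eq_mul, mul_one, one_mul, Complex.real_smul, mul_comm]

theorem typeProj_mem {κ : ℂ} {N : Submodule ℂ (ℂ ⊗[ℝ] V)}
    (hN : ∀ w, D.η (D.diracCurrent s s) w = 0 → D.typeVector s κ w ∈ N) (v : ℂ ⊗[ℝ] V) :
    D.typeProj s κ v ∈ N := by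
  induction v using TensorProduct.induction_on with
  | zero => rw [map_zero]; exact zero_mem _
  | add v v' hv hv' => rw [map_add]; exact add_mem hv hv'
  | tmul c r =>
    obtain ⟨w, hw, h⟩ := D.typeProj_tmul hs κ c r
    rw [h]
    exact Submodule.smul_mem _ _ (hN w hw)

omit hs

theorem typeVector_mem_W10 {w : V} (hw : D.η (D.diracCurrent s s) w = 0) :
    D.typeVector s Complex.I w ∈ D.W10 s :=
  Submodule.subset_span ⟨w, hw, rfl⟩

theorem typeVector_mem_W01 {w : V} (hw : D.η (D.diracCurrent s s) w = 0) :
    D.typeVector s (-Complex.I) w ∈ D.W01 s :=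
  Submodule.subset_span ⟨w, hw, by rw [typeVector, TensorProduct.neg_tmul, sub_neg_eq_add]⟩

theorem W10_le {N : Submodule ℂ (ℂ ⊗[ℝ] V)}
    (hN : ∀ w, D.η (D.diracCurrent s s) w = 0 → D.typeVector s Complex.I w ∈ N) :
    D.W10 s ≤ N := by
  refine Submodule.span_le.mpr ?_
  rintro _ ⟨w, hw, rfl⟩
  exact hN w hw

theorem W01_le {N : Submodule ℂ (ℂ ⊗[ℝ] V)}
    (hN : ∀ w, D.η (D.diracCurrent s s) w = 0 → D.typeVector s (-Complex.I) w ∈ N) :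
    D.W01 s ≤ N := by
  refine Submodule.span_le.mpr ?_
  rintro _ ⟨w, hw, rfl⟩
  have h := hN w hw
  rwa [typeVector, TensorProduct.neg_tmul, sub_neg_eq_add] at h

theorem typeProj_add (v : ℂ ⊗[ℝ] V) :
    D.complexSpinors.η ((1 : ℂ) ⊗ₜ D.unitCurrent s) v • ((1 : ℂ) ⊗ₜ[ℝ] D.unitCurrent s) +
      D.typeProj s Complex.I v + D.typeProj s (-Complex.I) v = v := by
  rw [typeProj_apply, typeProj_apply]
  module

include hs

/-- The Dirac current of a chiral part is a multiple of `ξ`. -/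
theorem chiralPart_pure (κ : ℂ) {n : ℂ ⊗[ℝ] V}
    (hn : D.complexSpinors.η ((1 : ℂ) ⊗ₜ D.unitCurrent s) n = 0) :
    D.BC (D.chiralPart s κ) (D.γC n (D.chiralPart s κ)) = 0 := by
  let N : Submodule ℂ (ℂ ⊗[ℝ] V) :=
    LinearMap.ker (D.BC (D.chiralPart s κ) ∘ₗ D.γC.flip (D.chiralPart s κ))
  have hN : ∀ κ' w, D.η (D.diracCurrent s s) w = 0 → D.typeVector s κ' w ∈ N := fun κ' w hw => by
    refine Submodule.smul_mem _ _ (sub_mem ?_ ?_)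
    · exact D.BC_chiralPart_γC_tmul hs hw 1
    · exact D.BC_chiralPart_γC_tmul hs (D.η_diracCurrent_complexStructure hs w) κ'
  have h := D.typeProj_add (s := s) n
  rw [hn, zero_smul, zero_add] at h
  have hmem : n ∈ N := by
    rw [← h]
    exact add_mem (D.typeProj_mem hs (hN _) n) (D.typeProj_mem hs (hN _) n)
  exact hmem

/-- The polarization given by `W¹⁰`, `W⁰¹` and the two chiral parts of `s`. -/
def polarization : D.complexSpinors.Polarization where
  ℓ := (1 : ℂ) ⊗ₜ D.unitCurrent s
  U := D.W10 s
  U' := D.W01 s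
  P := D.typeProj s Complex.I
  P' := D.typeProj s (-Complex.I)
  ι := Complex.I
  z := D.chiralPart s Complex.I
  z' := D.chiralPart s (-Complex.I)
  η_ℓ := by
    change D.η.baseChange ℂ _ _ = 1
    rw [LinearMap.BilinForm.baseChange_tmul, D.η_unitCurrent_self hs]
    simp
  sum_eq := D.typeProj_add
  P_mem := D.typeProj_mem hs fun _ hw => D.typeVector_mem_W10 hw
  P'_mem := D.typeProj_mem hs fun _ hw => D.typeVector_mem_W01 hw
  adjoint := D.η_typeProj
  U_perp := D.W10_le (N := LinearMap.ker (D.complexSpinors.η _)) fun _ hw =>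
    D.η_tmul_unitCurrent_typeVector hs hw
  U'_perp := D.W01_le (N := LinearMap.ker (D.complexSpinors.η _)) fun _ hw =>
    D.η_tmul_unitCurrent_typeVector hs hw
  ι_ne_zero := Complex.I_ne_zero
  ℓ_z := D.γC_unitCurrent_chiralPart hs Complex.I_mul_I
  ℓ_z' := D.γC_unitCurrent_chiralPart hs (by rw [neg_mul_neg, Complex.I_mul_I])
  U_z := D.W10_le (N := LinearMap.ker (D.γC.flip _)) fun _ hw =>
    D.γC_typeVector_chiralPart hs Complex.I_mul_I hw
  U'_z' := D.W01_le (N := LinearMap.ker (D.γC.flip _)) fun _ hw =>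
    D.γC_typeVector_chiralPart hs (by rw [neg_mul_neg, Complex.I_mul_I]) hw
  pure := fun _ hn => D.chiralPart_pure hs _ hn
  pure' := fun _ hn => D.chiralPart_pure hs _ hn
  B_ne_zero := D.BC_chiralPart_chiralPart hs

theorem polarization_z_add_z' :
    (1 : ℂ) ⊗ₜ[ℝ] s = (D.polarization hs).z + (D.polarization hs).z' := by
  change _ = D.chiralPart s Complex.I + D.chiralPart s (-Complex.I)
  rw [chiralPart, chiralPart, TensorProduct.neg_tmul]
  module

theorem isOfType_of_mem_formsType {q r r' : ℕ}
    {θ : (ℂ ⊗[ℝ] V) [⋀^Fin q]→ₗ[ℂ] ℂ} (hθ : θ ∈ D.formsType s q r r') :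
    (D.polarization hs).IsOfType r θ := by
  refine ⟨fun v hv => ?_, fun A hA v h1 h2 => hθ.2 A (fun h => hA h.1) v h1 h2⟩
  obtain ⟨i, hi⟩ := hv
  have h1 : v = Function.update v i (((D.currentNorm s)⁻¹ : ℂ) •
      ((1 : ℂ) ⊗ₜ[ℝ] D.diracCurrent s s)) := by
    rw [TensorProduct.smul_tmul', smul_eq_mul, mul_one]
    have h2 : v i = (((D.currentNorm s)⁻¹ : ℂ)) ⊗ₜ[ℝ] D.diracCurrent s s := by
      rw [hi]
      change (1 : ℂ) ⊗ₜ[ℝ] D.unitCurrent s = _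
      rw [unitCurrent, TensorProduct.tmul_smul, TensorProduct.smul_tmul', Complex.real_smul,
        mul_one, Complex.ofReal_inv]
    rw [← h2, Function.update_eq_self]
  rw [h1, AlternatingMap.map_update_smul, hθ.1 _ ⟨i, Function.update_self _ _ _⟩, smul_zero]

omit hs

theorem component_apply (q : ℕ) (ω : (ℂ ⊗[ℝ] S) ⊗[ℂ] (ℂ ⊗[ℝ] S)) (v : Fin q → ℂ ⊗[ℝ] V) :
    D.component q ω v =
      TensorProduct.lift D.complexSpinors.B (LinearMap.lTensor _ (wedgeAction D.complexSpinors.γ q v) ω) := rfl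

theorem component_add (q : ℕ) (ω ω' : (ℂ ⊗[ℝ] S) ⊗[ℂ] (ℂ ⊗[ℝ] S)) :
    D.component q (ω + ω') = D.component q ω + D.component q ω' := by
  ext v
  simp [component, bispinorPairing]

theorem mem_diracKernel {ω : (ℂ ⊗[ℝ] S) ⊗[ℂ] (ℂ ⊗[ℝ] S)}
    (h : ω ∈ Submodule.span ℂ {ω | ∃ t : ℂ ⊗[ℝ] S,
      D.complexSpinors.B ((1 : ℂ) ⊗ₜ[ℝ] s) t = 0 ∧ ω = t ⊗ₜ[ℂ] t})
    (h1 : D.component 1 ω = 0) : ω ∈ D.diracKernel (D.orthogonalOfSpinor s) := by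
  refine ⟨Submodule.span_mono ?_ h, h1⟩
  rintro _ ⟨t, ht, rfl⟩
  refine ⟨t, ?_, rfl⟩
  intro n hn
  obtain ⟨c, rfl⟩ := Submodule.mem_span_singleton.mp hn
  change D.BC (c • _) t = 0
  rw [map_smul, LinearMap.smul_apply]
  exact (congrArg (c • ·) ht).trans (smul_zero c)

theorem η_ℓ_tmul (p : D.complexSpinors.Polarization)
    (hp : p.ℓ = (1 : ℂ) ⊗ₜ D.unitCurrent s) {w : V} (hw : D.η (D.diracCurrent s s) w = 0) :
    D.complexSpinors.η p.ℓ ((1 : ℂ) ⊗ₜ w) = 0 := by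
  rw [hp]
  change D.η.baseChange ℂ _ _ = 0
  rw [LinearMap.BilinForm.baseChange_tmul, D.η_unitCurrent_eq_zero hw, zero_smul]

theorem exists_diracKernel_two (p : D.complexSpinors.Polarization)
    (hp : p.ℓ = (1 : ℂ) ⊗ₜ D.unitCurrent s) (hz : (1 : ℂ) ⊗ₜ[ℝ] s = p.z + p.z')
    {θ : (ℂ ⊗[ℝ] V) [⋀^Fin 2]→ₗ[ℂ] ℂ} (hθ : p.IsOfType 2 θ) :
    ∃ ω ∈ D.diracKernel (D.orthogonalOfSpinor s),
      D.component 2 ω = θ ∧ D.component 5 ω ∈ D.formsXiW s 5 := by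
  obtain ⟨ω, hω, h1, h2, h5⟩ := p.exists_of_two_form hθ hz
  refine ⟨ω, D.mem_diracKernel hω (AlternatingMap.ext h1), AlternatingMap.ext h2, fun w hw => ?_⟩
  rw [component_apply]
  exact h5 _ fun i => D.η_ℓ_tmul p hp (hw i)

include hs in
theorem exists_diracKernel_five (p : D.complexSpinors.Polarization)
    (hp : p.ℓ = (1 : ℂ) ⊗ₜ D.unitCurrent s) (hz : (1 : ℂ) ⊗ₜ[ℝ] s = p.z + p.z')
    {r : ℕ} (hr : r = 3 ∨ r = 4)
    {θ : (ℂ ⊗[ℝ] V) [⋀^Fin 5]→ₗ[ℂ] ℂ} (hθ : p.IsOfType r θ) :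
    ∃ ω ∈ D.diracKernel (D.orthogonalOfSpinor s),
      D.component 2 ω ∈ D.formsW s 2 ∧ (r = 3 → D.component 2 ω = 0) ∧
      D.component 5 ω - θ ∈ D.formsXiW s 5 := by
  obtain ⟨ω, hω, h1, h2, h5⟩ := p.exists_of_five_form hr hθ hz
  refine ⟨ω, D.mem_diracKernel hω (AlternatingMap.ext h1), ?_, ?_, fun w hw => ?_⟩
  · rintro v ⟨i, hi⟩
    have hξ : v i = (D.currentNorm s : ℂ) • p.ℓ := by
      rw [hi, hp, TensorProduct.smul_tmul', smul_eq_mul, mul_one, unitCurrent,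
        TensorProduct.tmul_smul, TensorProduct.smul_tmul', Complex.real_smul,
        Complex.ofReal_inv, inv_mul_cancel₀ (by exact_mod_cast (D.currentNorm_pos hs).ne')]
    have h3 : v = Function.update v i ((D.currentNorm s : ℂ) • p.ℓ) := by
      rw [← hξ, Function.update_eq_self]
    rw [h3, AlternatingMap.map_update_smul]
    exact (congrArg (_ • ·) (h2 _ (Or.inr ⟨i, Function.update_self _ _ _⟩))).trans (smul_zero _)
  · exact fun hr => AlternatingMap.ext fun v => h2 v (Or.inl hr)
  · rw [AlternatingMap.sub_apply, sub_eq_zero]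
    rw [component_apply]
    exact h5 _ fun i => D.η_ℓ_tmul p hp (hw i)

end SpinorData


end ElevenDim

end

theorem proposition4p2 {V S : Type*} [AddCommGroup V] [Module ℝ V] [AddCommGroup S] [Module ℝ S]
    (D : ElevenDim.SpinorData V S) (s : S)
    (hs : 0 < D.η (D.diracCurrent s s) (D.diracCurrent s s)) :
    (∀ θ ∈ D.formsType s 2 2 0 ⊔ D.formsType s 2 0 2,
      ∃ ω ∈ D.diracKernel (D.orthogonalOfSpinor s),
        D.component 2 ω = θ ∧ D.component 5 ω ∈ D.formsXiW s 5) ∧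
    (∀ θ ∈ D.formsType s 5 4 1 ⊔ D.formsType s 5 1 4,
      ∃ ω ∈ D.diracKernel (D.orthogonalOfSpinor s),
        D.component 2 ω ∈ D.formsW s 2 ∧ D.component 5 ω - θ ∈ D.formsXiW s 5) ∧
    (∀ θ ∈ D.formsType s 5 3 2 ⊔ D.formsType s 5 2 3,
      ∃ ω ∈ D.diracKernel (D.orthogonalOfSpinor s),
        D.component 2 ω = 0 ∧ D.component 5 ω - θ ∈ D.formsXiW s 5) := by
  set p := D.polarization hs with hp
  have hz := D.polarization_z_add_z' hs
  have hz' : (1 : ℂ) ⊗ₜ[ℝ] s = p.symm.z + p.symm.z' := hz.trans (add_comm _ _)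
  refine ⟨fun θ hθ => ?_, fun θ hθ => ?_, fun θ hθ => ?_⟩
  · obtain ⟨θ₁, h₁, θ₂, h₂, rfl⟩ := Submodule.mem_sup.mp hθ
    have t₁ := D.isOfType_of_mem_formsType hs h₁
    have t₂ := (D.isOfType_of_mem_formsType hs h₂).symm (Nat.zero_le 2)
    obtain ⟨ω₁, k₁, e₁, f₁⟩ := D.exists_diracKernel_two p rfl hz t₁
    obtain ⟨ω₂, k₂, e₂, f₂⟩ := D.exists_diracKernel_two p.symm rfl hz' t₂
    refine ⟨ω₁ + ω₂, add_mem k₁ k₂, ?_, ?_⟩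
    · rw [D.component_add, e₁, e₂]
    · rw [D.component_add]; exact add_mem f₁ f₂
  · obtain ⟨θ₁, h₁, θ₂, h₂, rfl⟩ := Submodule.mem_sup.mp hθ
    have t₁ := D.isOfType_of_mem_formsType hs h₁
    have t₂ := (D.isOfType_of_mem_formsType hs h₂).symm (by norm_num)
    obtain ⟨ω₁, k₁, e₁, -, f₁⟩ := D.exists_diracKernel_five hs p rfl hz (Or.inr rfl) t₁
    obtain ⟨ω₂, k₂, e₂, -, f₂⟩ := D.exists_diracKernel_five hs p.symm rfl hz' (Or.inr rfl) t₂
    refine ⟨ω₁ + ω₂, add_mem k₁ k₂, ?_, ?_⟩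
    · rw [D.component_add]; exact add_mem e₁ e₂
    · rw [D.component_add, add_sub_add_comm]; exact add_mem f₁ f₂
  · obtain ⟨θ₁, h₁, θ₂, h₂, rfl⟩ := Submodule.mem_sup.mp hθ
    have t₁ := D.isOfType_of_mem_formsType hs h₁
    have t₂ := (D.isOfType_of_mem_formsType hs h₂).symm (by norm_num)
    obtain ⟨ω₁, k₁, -, e₁, f₁⟩ := D.exists_diracKernel_five hs p rfl hz (Or.inl rfl) t₁
    obtain ⟨ω₂, k₂, -, e₂, f₂⟩ := D.exists_diracKernel_five hs p.symm rfl hz' (Or.inl rfl) t₂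
    refine ⟨ω₁ + ω₂, add_mem k₁ k₂, ?_, ?_⟩
    · rw [D.component_add, e₁ rfl, e₂ rfl, add_zero]
    · rw [D.component_add, add_sub_add_comm]; exact add_mem f₁ f₂
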